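/- Let $n\ge 1$, $s\in(0,1)$ and $\gamma>0$. For a smooth compactly supported function $f$ on $\mathbb R^n$ put $$(-\Delta)^s f(x)=c_{n,s}\,\mathrm{PV}\!\int_{\mathbb R^n}\bigl(f(x)-f(x+z)\bigr)\frac{dz}{|z|^{n+2s}},$$ where $c_{n,s}>0$ is the usual normalization constant. Let $\varphi:\mathbb R^n\to\mathbb R$ satisfy $$\varphi\in C^{3,\gamma}(\mathbb R^n),\qquad \Delta\varphi\le 0\ \text{ in }\{\varphi>0\},\qquad \emptyset\ne\{\varphi>0\}\subset\subset\mathbb R^n,$$ where $C^{3,\gamma}(\mathbb R^n)$ is the set of $C^3$ functions whose third derivatives are locally Hölder continuous of exponent $\gamma$. Let $u:\mathbb R^n\to\mathbb R$ be a continuous solution of the global obstacle problem $$\min\{u-\varphi,\,(-\Delta)^s u\}=0\ \text{ in }\mathbb R^n,\qquad \lim_{|x|\to\infty}u(x)=0,$$ that is, $u(x)\to0$ as $|x|\to\infty$, $u\ge\varphi$ in $\mathbb R^n$, $(-\Delta)^s u\ge 0$ in $\mathbb R^n$, and $(-\Delta)^s u=0$ in the open set $\{u>\varphi\}$, the last two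 in the sense of distributions: $\int_{\mathbb R^n} u\,(-\Delta)^s\eta\,dx\ge0$ for every $0\le\eta\in C_c^\infty(\mathbb R^n)$, and $\int_{\mathbb R^n} u\,(-\Delta)^s\eta\,dx=0$ for every $\eta\in C_c^\infty(\{u>\varphi\})$. Let $\Gamma(u)=\partial\{u=\varphi\}$ be the free boundary. Then there exist constants $c_1,r_1>0$ such that, for every $x_0\in\Gamma(u)$, $$\sup_{B_r(x_0)}(u-\varphi)\ \ge\ c_1 r^2\qquad\text{for all } r\in(0,r_1).$$ -/

import Mathlib

open Set Filter Topology MeasureTheory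
open scoped NNReal ContDiff

namespace FracObstacle

noncomputable section

/-- The normalization constant of the fractional Laplacian,
`c_{n,s} = 4^s s Γ(n/2 + s) / (π^{n/2} Γ(1 - s))`, positive for `0 < s < 1`. -/
def fracConst (n : ℕ) (s : ℝ) : ℝ :=
  (4 : ℝ) ^ s * s * Real.Gamma ((n : ℝ) / 2 + s) /
    (Real.pi ^ ((n : ℝ) / 2) * Real.Gamma (1 - s))

/-- The fractional Laplacian as a principal value,
`(-Δ)^s f(x) = c_{n,s} lim_{ε ↓ 0} ∫_{|z| > ε} (f(x) - f(x + z)) / |z|^{n + 2s} dz`.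
It is only used on smooth compactly supported `f`, for which the limit exists at every `x`. -/
def fracLaplacian {n : ℕ} (s : ℝ) (f : EuclideanSpace ℝ (Fin n) → ℝ)
    (x : EuclideanSpace ℝ (Fin n)) : ℝ :=
  fracConst n s * limUnder (𝓝[>] (0 : ℝ)) fun ε : ℝ =>
    ∫ z in {z : EuclideanSpace ℝ (Fin n) | ε < ‖z‖},
      (f x - f (x + z)) / ‖z‖ ^ ((n : ℝ) + 2 * s)

/-- `(-Δ)^s u ≥ 0` in `ℝⁿ`, in the sense of distributions. -/
def FracSuperharmonic {n : ℕ} (s : ℝ) (u : EuclideanSpace ℝ (Fin n) → ℝ) : Prop :=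
  ∀ η : EuclideanSpace ℝ (Fin n) → ℝ, ContDiff ℝ ∞ η → HasCompactSupport η →
    (∀ x, 0 ≤ η x) → 0 ≤ ∫ x, u x * fracLaplacian s η x

/-- `(-Δ)^s u = 0` in the open set `U`, in the sense of distributions. -/
def FracHarmonicOn {n : ℕ} (s : ℝ) (u : EuclideanSpace ℝ (Fin n) → ℝ)
    (U : Set (EuclideanSpace ℝ (Fin n))) : Prop :=
  ∀ η : EuclideanSpace ℝ (Fin n) → ℝ, ContDiff ℝ ∞ η → HasCompactSupport η →
    tsupport η ⊆ U → ∫ x, u x * fracLaplacian s η x = 0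

/-- `u` is a (continuous) solution of the global obstacle problem
`min {u - φ, (-Δ)^s u} = 0` in `ℝⁿ`, `u(x) → 0` as `|x| → ∞`: that is, `u ≥ φ` and
`(-Δ)^s u ≥ 0` in `ℝⁿ`, with `(-Δ)^s u = 0` where `u > φ`. -/
structure IsGlobalSolution {n : ℕ} (s : ℝ) (φ u : EuclideanSpace ℝ (Fin n) → ℝ) : Prop where
  continuous : Continuous u
  tendsto_zero : Tendsto u (cocompact (EuclideanSpace ℝ (Fin n))) (𝓝 0)
  obstacle_le : ∀ x, φ x ≤ u x
  superharmonic : FracSuperharmonic s u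
  harmonic_off_contact : FracHarmonicOn s u {x | φ x < u x}

/-- `φ ∈ C^{3,γ}(ℝⁿ)`: `φ` is three times continuously differentiable and its third derivative
is locally Hölder continuous of exponent `γ` (no growth condition at infinity is imposed). -/
def IsC3Holder {n : ℕ} (γ : ℝ≥0) (φ : EuclideanSpace ℝ (Fin n) → ℝ) : Prop :=
  ContDiff ℝ 3 φ ∧ ∀ R : ℝ, ∃ C : ℝ≥0,
    HolderOnWith C γ (iteratedFDeriv ℝ 3 φ) (Metric.closedBall 0 R)

/-- The assumptions on the obstacle of the global problem: `φ ∈ C^{3,γ}(ℝⁿ)`, `Δφ ≤ 0` in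
`{φ > 0}`, and `∅ ≠ {φ > 0} ⊂⊂ ℝⁿ`. -/
structure IsGlobalObstacle {n : ℕ} (γ : ℝ≥0) (φ : EuclideanSpace ℝ (Fin n) → ℝ) : Prop where
  regular : IsC3Holder γ φ
  laplacian_nonpos : ∀ x, 0 < φ x → Laplacian.laplacian φ x ≤ 0
  nonempty : {x | 0 < φ x}.Nonempty
  compactly_contained : IsCompact (closure {x | 0 < φ x})

/-- The free boundary `Γ(u) = ∂{u = φ}`. -/
def freeBoundary {n : ℕ} (φ u : EuclideanSpace ℝ (Fin n) → ℝ) :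
    Set (EuclideanSpace ℝ (Fin n)) :=
  frontier {x | u x = φ x}

end

end FracObstacle

/-! ### The kernel, and bounds for second differences in L¹ and in sup norm. -/

namespace FracObstacle

/-! Formally, μ = (-Δ)^s u is a nonnegative measure carried by the contact set K = {u = φ}. Since φ
is positive somewhere, so is u, and the strong minimum principle (`FracSuperharmonic.pos`) gives u >
0 everywhere. Hence K lies in {φ > 0}, so K is compact, and μ is not zero.

The key identity is -Δ = (-Δ)^{1-s} (-Δ)^s. At a point x off K, where μ vanishes, the operator of
order 2(1-s) sees only the nonlocal contribution of μ: -Δu(x) is a negative multiple of ∫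
|x-y|^{-n-2(1-s)} dμ(y). As μ has positive mass and bounded support, Δu ≥ c > 0 off K in every
bounded region (`exists_le_laplacian_convol`). Near K one has Δφ ≤ 0, so Δ(u-φ) ≥ c off K, and the
classical comparison of u-φ with a paraboloid centred at a noncontact point gives quadratic growth
(`exists_mul_sq_le_of_laplacian`).

Since u is only continuous, every step is carried out on mollifications u*ρ, with μ replaced by
u*(Lρ), where L = `secondDiffLaplacian s` is a positive multiple of (-Δ)^s on test functions. The
composition identity is needed only for L acting on test functions, where it follows from Fourier
transforms (`exists_secondDiffLaplacian_comp_eq`). The lower bound is uniform in the mollifier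
because the integral of u*(Lρ) does not depend on ρ (`integral_convol_secondDiffLaplacian_eq`). -/

/-- Euclidean space `ℝⁿ`. -/
abbrev Euc (n : ℕ) := EuclideanSpace ℝ (Fin n)

/-- The kernel `|z|^{-(n+2s)}` of the fractional Laplacian. -/
noncomputable def fracKernel {n : ℕ} (s : ℝ) (z : Euc n) : ℝ := (‖z‖ ^ ((n : ℝ) + 2 * s))⁻¹

/-- The symmetric second difference `2 f(x) - f(x + z) - f(x - z)`. -/
def secondDiff {n : ℕ} {F : Type*} [AddCommGroup F] (f : Euc n → F) (z x : Euc n) : F :=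
  (f x - f (x + z)) + (f x - f (x - z))

/-- The fractional Laplacian in terms of second differences, without normalization. -/
noncomputable def secondDiffLaplacian {n : ℕ} (s : ℝ) (f : Euc n → ℝ) (x : Euc n) : ℝ :=
  ∫ z, secondDiff f z x * fracKernel s z

/-- The truncation `min(1, |z|²)`. -/
noncomputable def truncSq {n : ℕ} (z : Euc n) : ℝ := min 1 (‖z‖ ^ 2)

variable {n : ℕ} {s : ℝ}

lemma truncSq_nonneg (z : Euc n) : 0 ≤ truncSq z := le_min zero_le_one (sq_nonneg _)

lemma fracKernel_nonneg (z : Euc n) : 0 ≤ fracKernel s z := by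
  unfold fracKernel; positivity

lemma fracKernel_pos {z : Euc n} (hz : z ≠ 0) : 0 < fracKernel s z := by
  unfold fracKernel
  have := norm_pos_iff.2 hz
  positivity

@[fun_prop]
lemma measurable_fracKernel : Measurable (fracKernel s : Euc n → ℝ) := by
  unfold fracKernel; fun_prop

@[fun_prop]
lemma measurable_truncSq : Measurable (truncSq : Euc n → ℝ) := by
  unfold truncSq; fun_prop

/-- In polar coordinates the density is r^{1-2s} near zero and r^{-1-2s} at infinity; these are
integrable exactly because s < 1 and s > 0. -/
lemma integrable_truncSq_mul_fracKernel [NeZero n] (hs0 : 0 < s) (hs1 : s < 1) :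
    Integrable (fun z : Euc n => truncSq z * fracKernel s z) := by
  have h := (integrable_fun_norm_addHaar (volume : Measure (Euc n))
    (f := fun y : ℝ => min 1 (y ^ 2) * (y ^ ((n : ℝ) + 2 * s))⁻¹)).2
  refine h ?_
  have hn : 1 ≤ n := NeZero.one_le
  have hdim : Module.finrank ℝ (Euc n) = n := by simp
  rw [hdim]
  have key : ∀ y : ℝ, 0 < y → y ^ (n - 1) • (min 1 (y ^ 2) * (y ^ ((n : ℝ) + 2 * s))⁻¹) =
      min 1 (y ^ 2) * y ^ (-1 - 2 * s) := by
    intro y hy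
    rw [smul_eq_mul, ← Real.rpow_neg hy.le, mul_left_comm, ← Real.rpow_natCast y (n - 1),
      ← Real.rpow_add hy]
    congr 2
    push_cast [hn]; ring
  rw [← Ioc_union_Ioi_eq_Ioi zero_le_one]
  refine IntegrableOn.union ?_ ?_
  · have h1 : IntegrableOn (fun y : ℝ => y ^ (1 - 2 * s)) (Ioc 0 1) :=
      (intervalIntegrable_iff_integrableOn_Ioc_of_le zero_le_one).1
        (intervalIntegral.intervalIntegrable_rpow' (by linarith))
    refine h1.congr_fun (fun y hy => ?_) measurableSet_Ioc
    dsimp only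
    rw [key y hy.1, min_eq_right (by nlinarith [hy.1, hy.2]), ← Real.rpow_natCast,
      ← Real.rpow_add hy.1]
    congr 1; push_cast; ring
  · have h1 : IntegrableOn (fun y : ℝ => y ^ (-1 - 2 * s)) (Ioi 1) :=
      integrableOn_Ioi_rpow_of_lt (by linarith) zero_lt_one
    refine h1.congr_fun (fun y hy => ?_) measurableSet_Ioi
    have hy' : (1 : ℝ) < y := hy
    dsimp only
    rw [key y (by linarith), min_eq_left (by nlinarith), one_mul]

section L1
variable {F : Type*} [NormedAddCommGroup F]

/-- The fundamental theorem of calculus along the segment from x to x + z, then Tonelli and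
translation invariance. -/
lemma lintegral_enorm_sub_translate_le [NormedSpace ℝ F] [CompleteSpace F]
    {f : Euc n → F} (hf : ContDiff ℝ 1 f) (z : Euc n) :
    ∫⁻ x, ‖f (x + z) - f x‖ₑ ≤ ‖z‖ₑ * ∫⁻ x, ‖fderiv ℝ f x‖ₑ := by
  have hc : Continuous (fderiv ℝ f) := hf.continuous_fderiv one_ne_zero
  have hpt : ∀ x, ‖f (x + z) - f x‖ₑ ≤
      ∫⁻ t in Ioc (0 : ℝ) 1, ‖fderiv ℝ f (x + t • z)‖ₑ * ‖z‖ₑ := by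
    intro x
    have hd : ∀ t ∈ uIcc (0 : ℝ) 1,
        HasDerivAt (fun t : ℝ => f (x + t • z)) (fderiv ℝ f (x + t • z) z) t := by
      intro t _
      have h1 : HasDerivAt (fun t : ℝ => x + t • z) z t := by
        simpa using ((hasDerivAt_id t).smul_const z).const_add x
      exact ((hf.differentiable one_ne_zero (x + t • z)).hasFDerivAt).comp_hasDerivAt t h1
    have hi : IntervalIntegrable (fun t : ℝ => fderiv ℝ f (x + t • z) z) volume 0 1 := by
      apply Continuous.intervalIntegrable; fun_prop
    have := intervalIntegral.integral_eq_sub_of_hasDerivAt hd hi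
    simp only [one_smul, zero_smul, add_zero] at this
    rw [← this, intervalIntegral.integral_of_le zero_le_one]
    refine (enorm_integral_le_lintegral_enorm _).trans (lintegral_mono fun t => ?_)
    exact ContinuousLinearMap.le_opENorm _ _
  calc ∫⁻ x, ‖f (x + z) - f x‖ₑ
      ≤ ∫⁻ x, ∫⁻ t in Ioc (0 : ℝ) 1, ‖fderiv ℝ f (x + t • z)‖ₑ * ‖z‖ₑ := lintegral_mono hpt
    _ = ∫⁻ t in Ioc (0 : ℝ) 1, ∫⁻ x, ‖fderiv ℝ f (x + t • z)‖ₑ * ‖z‖ₑ := by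
        apply lintegral_lintegral_swap
        apply Measurable.aemeasurable
        apply Continuous.measurable
        have : Continuous fun p : Euc n × ℝ => fderiv ℝ f (p.1 + p.2 • z) := by fun_prop
        exact ENNReal.continuous_mul_const (by simp) |>.comp this.enorm
    _ = ∫⁻ t in Ioc (0 : ℝ) 1, ‖z‖ₑ * ∫⁻ x, ‖fderiv ℝ f x‖ₑ := by
        congr 1; ext t
        rw [lintegral_mul_const _ (by fun_prop), mul_comm,
          lintegral_add_right_eq_self (fun x => ‖fderiv ℝ f x‖ₑ)]
    _ = _ := by simp

lemma fderiv_translate_sub [NormedSpace ℝ F] {f : Euc n → F} (hf : Differentiable ℝ f) (z : Euc n) :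
    fderiv ℝ (fun x => f (x + z) - f x) = fun x => fderiv ℝ f (x + z) - fderiv ℝ f x := by
  ext1 x
  rw [fderiv_fun_sub (by fun_prop) (by fun_prop), fderiv_comp_add_right]

lemma fderiv_secondDiff [NormedSpace ℝ F] {f : Euc n → F} (hf : Differentiable ℝ f) (z : Euc n) :
    fderiv ℝ (secondDiff f z) = secondDiff (fderiv ℝ f) z := by
  ext1 x
  unfold secondDiff
  rw [fderiv_fun_add (by fun_prop) (by fun_prop), fderiv_fun_sub (by fun_prop) (by fun_prop),
    fderiv_fun_sub (by fun_prop) (by fun_prop), fderiv_comp_add_right, fderiv_comp_sub]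

/-- A second difference is the difference, under translation by -z, of the first difference under
translation by z, so the first-order bound applies twice. -/
lemma lintegral_enorm_secondDiff_le_sq [NormedSpace ℝ F] [CompleteSpace F]
    {f : Euc n → F} (hf : ContDiff ℝ 2 f) (z : Euc n) :
    ∫⁻ x, ‖secondDiff f z x‖ₑ ≤ ‖z‖ₑ * (‖z‖ₑ * ∫⁻ x, ‖fderiv ℝ (fderiv ℝ f) x‖ₑ) := by
  have hd : ContDiff ℝ 1 (fderiv ℝ f) := hf.fderiv_right (by norm_num)
  have hg : ContDiff ℝ 1 (fun x => f (x + z) - f x) := by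
    have : ContDiff ℝ 1 f := hf.of_le (by norm_num)
    fun_prop
  have h1 := lintegral_enorm_sub_translate_le hg (-z)
  rw [fderiv_translate_sub (hf.differentiable (by norm_num)), enorm_neg] at h1
  have h2 := lintegral_enorm_sub_translate_le hd z
  refine le_trans (le_of_eq ?_) (h1.trans (mul_le_mul_right h2 _))
  congr 1; ext x
  congr 1
  simp only [secondDiff, ← sub_eq_add_neg, sub_add_cancel]
  abel

lemma lintegral_enorm_secondDiff_le {f : Euc n → F} (hf : Measurable fun x => ‖f x‖ₑ) (z : Euc n) :
    ∫⁻ x, ‖secondDiff f z x‖ₑ ≤ 4 * ∫⁻ x, ‖f x‖ₑ := by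
  calc ∫⁻ x, ‖secondDiff f z x‖ₑ
      ≤ ∫⁻ x, ((‖f x‖ₑ + ‖f (x + z)‖ₑ) + (‖f x‖ₑ + ‖f (x - z)‖ₑ)) := by
        refine lintegral_mono fun x => ?_
        exact (enorm_add_le _ _).trans (add_le_add enorm_sub_le enorm_sub_le)
    _ = 4 * ∫⁻ x, ‖f x‖ₑ := by
        have e1 := lintegral_add_right_eq_self (μ := volume) (fun x => ‖f x‖ₑ) z
        have e2 := lintegral_sub_right_eq_self (μ := volume) (fun x => ‖f x‖ₑ) z
        have m1 : Measurable fun x => ‖f (x + z)‖ₑ := hf.comp (measurable_add_const z)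
        have m2 : Measurable fun x => ‖f x‖ₑ + ‖f (x + z)‖ₑ := hf.add m1
        rw [lintegral_add_left m2, lintegral_add_left hf, lintegral_add_left hf, e1, e2]
        ring

lemma norm_secondDiff_le_sq [NormedSpace ℝ F] {f : Euc n → F} (hf : ContDiff ℝ 2 f) {A : ℝ}
    (hA : ∀ x, ‖fderiv ℝ (fderiv ℝ f) x‖ ≤ A) (z x : Euc n) :
    ‖secondDiff f z x‖ ≤ A * ‖z‖ ^ 2 := by
  have hd : ContDiff ℝ 1 (fderiv ℝ f) := hf.fderiv_right (by norm_num)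
  have hdiff : Differentiable ℝ f := hf.differentiable (by norm_num)
  have h1 : ∀ y, ‖fderiv ℝ f (y + z) - fderiv ℝ f y‖ ≤ A * ‖z‖ := fun y => by
    have := convex_univ.norm_image_sub_le_of_norm_fderiv_le (𝕜 := ℝ) (f := fderiv ℝ f)
      (x := y) (y := y + z) (C := A)
      (fun w _ => hd.differentiable one_ne_zero w) (fun w _ => hA w) trivial trivial
    simpa using this
  have hg : Differentiable ℝ (fun x => f (x + z) - f x) := by fun_prop
  have := convex_univ.norm_image_sub_le_of_norm_fderiv_le (𝕜 := ℝ) (f := fun x => f (x + z) - f x)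
      (x := x) (y := x - z) (C := A * ‖z‖)
      (fun w _ => hg w) (fun w _ => by rw [fderiv_translate_sub hdiff]; exact h1 w)
      trivial trivial
  have e : secondDiff f z x = (fun x => f (x + z) - f x) (x - z) - (fun x => f (x + z) - f x) x := by
    simp only [secondDiff, sub_add_cancel]; abel
  rw [e]
  refine this.trans (le_of_eq ?_)
  simp; ring

lemma norm_secondDiff_le {f : Euc n → F} {B : ℝ} (hB : ∀ x, ‖f x‖ ≤ B) (z x : Euc n) :
    ‖secondDiff f z x‖ ≤ 4 * B := by
  have h1 := norm_add_le (f x - f (x + z)) (f x - f (x - z))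
  have h2 := norm_sub_le (f x) (f (x + z))
  have h3 := norm_sub_le (f x) (f (x - z))
  have := hB x
  have := hB (x + z)
  have := hB (x - z)
  unfold secondDiff
  linarith

end L1

end FracObstacle

/-! ### Regularity classes on which the nonlocal operator is an absolutely convergent integral. -/

namespace FracObstacle

/-- Smooth compactly supported functions. -/
structure IsTestFunction {n : ℕ} {F : Type*} [NormedAddCommGroup F] [NormedSpace ℝ F]
    (f : Euc n → F) : Prop where
  contDiff : ContDiff ℝ ∞ f
  compact : HasCompactSupport f

/-- Integrable functions whose second differences are bounded in `L¹` by a multiple of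
`min(1, |z|²)`. -/
structure IsL1Regular {n : ℕ} (g : Euc n → ℝ) : Prop where
  measurable : Measurable g
  integrable : Integrable g
  bound : ∃ C : ℝ≥0, ∀ z, ∫⁻ x, ‖secondDiff g z x‖ₑ ≤ C * ENNReal.ofReal (truncSq z)

/-- Continuous functions whose second differences are bounded by a multiple of
`min(1, |z|²)`. -/
structure IsSupRegular {n : ℕ} (v : Euc n → ℝ) : Prop where
  continuous : Continuous v
  bound : ∃ C : ℝ, ∀ z x, |secondDiff v z x| ≤ C * truncSq z

/-- The convolution `∫ v(y) g(x - y) dy`. -/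
noncomputable def convol {n : ℕ} (v g : Euc n → ℝ) (x : Euc n) : ℝ := ∫ y, v y * g (x - y)

variable {n : ℕ} {s : ℝ}

section Test
variable {F : Type*} [NormedAddCommGroup F] [NormedSpace ℝ F] {f : Euc n → F}

lemma IsTestFunction.fderiv (hf : IsTestFunction f) : IsTestFunction (fderiv ℝ f) :=
  ⟨hf.contDiff.fderiv_right (by simp), hf.compact.fderiv ℝ⟩

lemma IsTestFunction.continuous (hf : IsTestFunction f) : Continuous f := hf.contDiff.continuous

lemma IsTestFunction.differentiable (hf : IsTestFunction f) : Differentiable ℝ f :=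
  hf.contDiff.differentiable (by simp)

lemma IsTestFunction.contDiff_two (hf : IsTestFunction f) : ContDiff ℝ 2 f :=
  hf.contDiff.of_le (by norm_cast)

lemma IsTestFunction.exists_bound (hf : IsTestFunction f) : ∃ C, ∀ x, ‖f x‖ ≤ C :=
  hf.continuous.bounded_above_of_compact_support hf.compact

lemma IsTestFunction.integrable (hf : IsTestFunction f) : Integrable f :=
  hf.continuous.integrable_of_hasCompactSupport hf.compact

lemma IsTestFunction.translate (hf : IsTestFunction f) (z : Euc n) :
    IsTestFunction (fun x => f (x + z)) := by
  refine ⟨hf.contDiff.comp (contDiff_id.add contDiff_const), ?_⟩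
  exact hf.compact.comp_homeomorph (Homeomorph.addRight z)

lemma IsTestFunction.sub {g : Euc n → F} (hf : IsTestFunction f) (hg : IsTestFunction g) :
    IsTestFunction (fun x => f x - g x) :=
  ⟨hf.contDiff.sub hg.contDiff, by simpa [sub_eq_add_neg] using! hf.compact.add hg.compact.neg⟩

lemma IsTestFunction.add {g : Euc n → F} (hf : IsTestFunction f) (hg : IsTestFunction g) :
    IsTestFunction (fun x => f x + g x) :=
  ⟨hf.contDiff.add hg.contDiff, hf.compact.add hg.compact⟩

lemma IsTestFunction.secondDiff (hf : IsTestFunction f) (z : Euc n) :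
    IsTestFunction (secondDiff f z) := by
  have := hf.translate (-z)
  simp only [← sub_eq_add_neg] at this
  exact (hf.sub (hf.translate z)).add (hf.sub this)

lemma ofReal_truncSq (z : Euc n) : ENNReal.ofReal (truncSq z) = min 1 (‖z‖ₑ ^ 2) := by
  rw [truncSq, ENNReal.ofReal_min, ENNReal.ofReal_pow (norm_nonneg _), ofReal_norm,
    ENNReal.ofReal_one]

lemma IsTestFunction.lintegral_secondDiff_le [CompleteSpace F] (hf : IsTestFunction f)
    {C : ENNReal} (h1 : 4 * ∫⁻ x, ‖f x‖ₑ ≤ C)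
    (h2 : ∫⁻ x, ‖_root_.fderiv ℝ (_root_.fderiv ℝ f) x‖ₑ ≤ C) (z : Euc n) :
    ∫⁻ x, ‖FracObstacle.secondDiff f z x‖ₑ ≤ C * ENNReal.ofReal (truncSq z) := by
  rw [ofReal_truncSq]
  rcases min_choice 1 (‖z‖ₑ ^ 2) with h | h <;> rw [h]
  · rw [mul_one]
    exact (lintegral_enorm_secondDiff_le hf.continuous.enorm.measurable z).trans h1
  · refine (lintegral_enorm_secondDiff_le_sq hf.contDiff_two z).trans ?_
    rw [← mul_assoc, ← sq, mul_comm]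
    gcongr

lemma IsTestFunction.exists_lintegral_secondDiff_le [CompleteSpace F] (hf : IsTestFunction f) :
    ∃ C : ℝ≥0, 4 * ∫⁻ x, ‖f x‖ₑ ≤ C ∧ ∀ z,
      ∫⁻ x, ‖FracObstacle.secondDiff f z x‖ₑ ≤ C * ENNReal.ofReal (truncSq z) := by
  have i0 : ∫⁻ x, ‖f x‖ₑ < ⊤ := hf.integrable.2
  have i2 : ∫⁻ x, ‖_root_.fderiv ℝ (_root_.fderiv ℝ f) x‖ₑ < ⊤ := hf.fderiv.fderiv.integrable.2
  obtain ⟨C, hC⟩ : ∃ C : ℝ≥0,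
      (C : ENNReal) = (4 * ∫⁻ x, ‖f x‖ₑ) + ∫⁻ x, ‖_root_.fderiv ℝ (_root_.fderiv ℝ f) x‖ₑ :=
    ⟨_, ENNReal.coe_toNNReal
      (ENNReal.add_ne_top.2 ⟨ENNReal.mul_ne_top ENNReal.ofNat_ne_top i0.ne, i2.ne⟩)⟩
  have h1 : 4 * ∫⁻ x, ‖f x‖ₑ ≤ C := hC.symm ▸ le_self_add
  exact ⟨C, h1, hf.lintegral_secondDiff_le h1 (hC.symm ▸ le_add_self)⟩

lemma IsTestFunction.exists_norm_secondDiff_le (hf : IsTestFunction f) :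
    ∃ C : ℝ, ∀ z x, ‖FracObstacle.secondDiff f z x‖ ≤ C * truncSq z := by
  obtain ⟨A, hA⟩ := hf.exists_bound
  obtain ⟨B, hB⟩ := hf.fderiv.fderiv.exists_bound
  refine ⟨max (4 * A) B, fun z x => ?_⟩
  rcases min_choice 1 (‖z‖ ^ 2) with h | h
  · rw [truncSq, h, mul_one]
    exact (norm_secondDiff_le hA z x).trans (le_max_left _ _)
  · rw [truncSq, h]
    refine (norm_secondDiff_le_sq hf.contDiff_two hB z x).trans ?_
    gcongr
    exact le_max_right _ _

end Test

/-- Second differences commute with derivatives, so both bounds needed in the w variable already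
carry the factor in z. -/
lemma IsTestFunction.exists_lintegral_secondDiff_secondDiff_le {ρ : Euc n → ℝ}
    (hρ : IsTestFunction ρ) : ∃ C : ℝ≥0, ∀ w z,
      ∫⁻ x, ‖FracObstacle.secondDiff (FracObstacle.secondDiff ρ z) w x‖ₑ ≤
        C * ENNReal.ofReal (truncSq z) * ENNReal.ofReal (truncSq w) := by
  obtain ⟨C1, -, h1⟩ := hρ.exists_lintegral_secondDiff_le
  obtain ⟨C2, -, h2⟩ := hρ.fderiv.fderiv.exists_lintegral_secondDiff_le
  refine ⟨4 * C1 + C2, fun w z => ?_⟩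
  refine (hρ.secondDiff z).lintegral_secondDiff_le ?_ ?_ w
  · refine (mul_le_mul_right (h1 z) 4).trans ?_
    rw [← mul_assoc]
    gcongr
    push_cast
    exact le_self_add
  · rw [fderiv_secondDiff hρ.differentiable, fderiv_secondDiff hρ.fderiv.differentiable]
    refine (h2 z).trans ?_
    gcongr
    exact_mod_cast le_add_self

lemma IsTestFunction.isL1Regular {ρ : Euc n → ℝ} (hρ : IsTestFunction ρ) : IsL1Regular ρ := by
  obtain ⟨C, -, h⟩ := hρ.exists_lintegral_secondDiff_le
  exact ⟨hρ.continuous.measurable, hρ.integrable, C, h⟩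

lemma IsTestFunction.isSupRegular {ρ : Euc n → ℝ} (hρ : IsTestFunction ρ) : IsSupRegular ρ :=
  ⟨hρ.continuous, hρ.exists_norm_secondDiff_le⟩

lemma measurable_secondDiff_uncurry {g : Euc n → ℝ} (hg : Measurable g) :
    Measurable fun p : Euc n × Euc n => secondDiff g p.1 p.2 := by
  unfold secondDiff; fun_prop

lemma measurable_secondDiff {g : Euc n → ℝ} (hg : Measurable g) (z : Euc n) :
    Measurable (secondDiff g z) := by
  unfold secondDiff; fun_prop

lemma IsSupRegular.integrable [NeZero n] {v : Euc n → ℝ} (hv : IsSupRegular v) (hs0 : 0 < s)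
    (hs1 : s < 1) (x : Euc n) : Integrable (fun z => secondDiff v z x * fracKernel s z) := by
  obtain ⟨C, hC⟩ := hv.bound
  refine ((integrable_truncSq_mul_fracKernel hs0 hs1).const_mul C).mono' ?_ ?_
  · have : Measurable fun z => secondDiff v z x :=
      (measurable_secondDiff_uncurry hv.continuous.measurable).comp measurable_prodMk_right
    fun_prop
  · refine ae_of_all _ fun z => ?_
    rw [Real.norm_eq_abs, abs_mul, abs_of_nonneg (fracKernel_nonneg z), ← mul_assoc]
    exact mul_le_mul_of_nonneg_right (hC z x) (fracKernel_nonneg z)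

lemma lintegral_truncSq_mul_fracKernel_lt_top [NeZero n] (hs0 : 0 < s) (hs1 : s < 1) :
    ∫⁻ z : Euc n, ENNReal.ofReal (truncSq z) * ENNReal.ofReal (fracKernel s z) < ⊤ := by
  have h := (integrable_truncSq_mul_fracKernel (n := n) hs0 hs1).2
  simp only [HasFiniteIntegral] at h
  convert h using 3 with z
  rw [← ENNReal.ofReal_mul (truncSq_nonneg z), ← Real.enorm_of_nonneg]
  exact mul_nonneg (truncSq_nonneg z) (fracKernel_nonneg z)

lemma IsL1Regular.integrable_prod [NeZero n] {g : Euc n → ℝ} (hg : IsL1Regular g) (hs0 : 0 < s)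
    (hs1 : s < 1) :
    Integrable (fun p : Euc n × Euc n => secondDiff g p.1 p.2 * fracKernel s p.1)
      (volume.prod volume) := by
  obtain ⟨C, hC⟩ := hg.bound
  have hm := measurable_secondDiff_uncurry hg.measurable
  refine ⟨by fun_prop, ?_⟩
  rw [HasFiniteIntegral, lintegral_prod _ (by fun_prop)]
  calc ∫⁻ z, ∫⁻ x, ‖secondDiff g z x * fracKernel s z‖ₑ
      ≤ ∫⁻ z, C * (ENNReal.ofReal (truncSq z) * ENNReal.ofReal (fracKernel s z)) := by
        refine lintegral_mono fun z => ?_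
        simp only [enorm_mul]
        rw [lintegral_mul_const _ (measurable_secondDiff hg.measurable z).enorm,
          Real.enorm_of_nonneg (fracKernel_nonneg z), ← mul_assoc]
        gcongr
        exact hC z
    _ = C * ∫⁻ z, (ENNReal.ofReal (truncSq z) * ENNReal.ofReal (fracKernel s z)) :=
        lintegral_const_mul _ (by fun_prop)
    _ < ⊤ := ENNReal.mul_lt_top (by simp) (lintegral_truncSq_mul_fracKernel_lt_top hs0 hs1)

lemma measurable_secondDiffLaplacian {g : Euc n → ℝ} (hg : Measurable g) :
    Measurable (secondDiffLaplacian s g) := by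
  have hm := measurable_secondDiff_uncurry hg
  have : Measurable fun p : Euc n × Euc n => secondDiff g p.1 p.2 * fracKernel s p.1 := by fun_prop
  exact (this.stronglyMeasurable.integral_prod_left').measurable

lemma IsL1Regular.integrable_secondDiffLaplacian [NeZero n] {g : Euc n → ℝ} (hg : IsL1Regular g)
    (hs0 : 0 < s) (hs1 : s < 1) : Integrable (secondDiffLaplacian s g) :=
  (hg.integrable_prod hs0 hs1).integral_prod_right

lemma integral_sub_add_integral_sub {V : Type*} [NormedAddCommGroup V] [NormedSpace ℝ V]
    {a b c : Euc n → V} (ha : Integrable a) (hb : Integrable b)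
    (hc : Integrable c) :
    ((∫ x, a x) - ∫ x, b x) + ((∫ x, a x) - ∫ x, c x) = ∫ x, ((a x - b x) + (a x - c x)) := by
  rw [← integral_sub ha hb, ← integral_sub ha hc]
  exact (integral_add (ha.sub hb) (ha.sub hc)).symm

lemma secondDiff_secondDiffLaplacian [NeZero n] {v : Euc n → ℝ} (hv : IsSupRegular v)
    (hs0 : 0 < s) (hs1 : s < 1) (z x : Euc n) :
    secondDiff (secondDiffLaplacian s v) z x =
      ∫ w, secondDiff (secondDiff v w) z x * fracKernel s w := by
  have i := hv.integrable hs0 hs1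
  unfold secondDiffLaplacian
  rw [secondDiff, integral_sub_add_integral_sub (i _) (i _) (i _)]
  congr 1; ext w
  simp only [secondDiff]
  ring

/-- The image of a test function need not have compact support; this is the substitute that allows
the operator of order 2(1-s) to be applied next. The product bound in w and z is integrated against
the kernel in w. -/
lemma IsTestFunction.isL1Regular_secondDiffLaplacian [NeZero n] {ρ : Euc n → ℝ}
    (hρ : IsTestFunction ρ) (hs0 : 0 < s) (hs1 : s < 1) :
    IsL1Regular (secondDiffLaplacian s ρ) := by
  refine ⟨measurable_secondDiffLaplacian hρ.continuous.measurable,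
    hρ.isL1Regular.integrable_secondDiffLaplacian hs0 hs1, ?_⟩
  obtain ⟨C, hC⟩ := hρ.exists_lintegral_secondDiff_secondDiff_le
  have hfin := lintegral_truncSq_mul_fracKernel_lt_top (n := n) hs0 hs1
  obtain ⟨I, hI⟩ := ENNReal.lt_iff_exists_coe.1 hfin
  refine ⟨C * I, fun z => ?_⟩
  have hm : Measurable fun p : Euc n × Euc n =>
      FracObstacle.secondDiff (FracObstacle.secondDiff ρ p.2) z p.1 := by
    have := hρ.continuous.measurable
    unfold FracObstacle.secondDiff
    fun_prop
  calc ∫⁻ x, ‖FracObstacle.secondDiff (secondDiffLaplacian s ρ) z x‖ₑ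
      ≤ ∫⁻ x, ∫⁻ w, ‖FracObstacle.secondDiff (FracObstacle.secondDiff ρ w) z x‖ₑ *
          ENNReal.ofReal (fracKernel s w) := by
        refine lintegral_mono fun x => ?_
        rw [secondDiff_secondDiffLaplacian hρ.isSupRegular hs0 hs1]
        refine (enorm_integral_le_lintegral_enorm _).trans (le_of_eq ?_)
        congr 1; ext w
        rw [enorm_mul, Real.enorm_of_nonneg (fracKernel_nonneg w)]
    _ = ∫⁻ w, ∫⁻ x, ‖FracObstacle.secondDiff (FracObstacle.secondDiff ρ w) z x‖ₑ *
          ENNReal.ofReal (fracKernel s w) := by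
        apply lintegral_lintegral_swap
        fun_prop
    _ ≤ ∫⁻ w, (C * ENNReal.ofReal (truncSq z)) * (ENNReal.ofReal (truncSq w) *
          ENNReal.ofReal (fracKernel s w)) := by
        refine lintegral_mono fun w => ?_
        rw [lintegral_mul_const _
          (measurable_secondDiff (measurable_secondDiff hρ.continuous.measurable w) z).enorm,
          ← mul_assoc]
        gcongr
        refine (hC z w).trans (le_of_eq (by ring))
    _ = _ := by
        rw [lintegral_const_mul _ (by fun_prop), hI.1]
        push_cast
        ring

/-! ### Convolution of a bounded continuous function with an L¹ function, and its commutation with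
the operator. -/

section Convol

variable {v g : Euc n → ℝ} {B : ℝ}

lemma integrable_convol (hv : Continuous v) (hB : ∀ x, |v x| ≤ B) (hg : Integrable g)
    (x : Euc n) : Integrable (fun y => v y * g (x - y)) :=
  (hg.comp_sub_left x).bdd_mul hv.aestronglyMeasurable (ae_of_all _ hB)

lemma convol_eq (v g : Euc n → ℝ) (x : Euc n) : convol v g x = ∫ y, v (x - y) * g y := by
  rw [convol, ← integral_sub_left_eq_self (fun y => v y * g (x - y)) volume x]
  simp

lemma continuous_convol (hv : Continuous v) (hB : ∀ x, |v x| ≤ B) (hg : Integrable g) :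
    Continuous (convol v g) := by
  have : convol v g = fun x => ∫ y, v (x - y) * g y := funext (convol_eq v g)
  rw [this]
  refine MeasureTheory.continuous_of_dominated (bound := fun y => B * ‖g y‖) (fun x => ?_) (fun x => ?_)
    (hg.norm.const_mul B) ?_
  · exact (by fun_prop : Continuous fun y => v (x - y)).aestronglyMeasurable.mul
      hg.aestronglyMeasurable
  · refine ae_of_all _ fun y => ?_
    rw [norm_mul]
    exact mul_le_mul_of_nonneg_right (hB _) (norm_nonneg _)
  · refine ae_of_all _ fun y => ?_
    exact (by fun_prop : Continuous fun x => v (x - y)).mul continuous_const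

lemma abs_convol_le (hB : ∀ x, |v x| ≤ B) (hg : Integrable g) (x : Euc n) :
    |convol v g x| ≤ B * ∫ y, ‖g y‖ := by
  rw [convol_eq, ← integral_const_mul, ← Real.norm_eq_abs]
  refine norm_integral_le_of_norm_le (hg.norm.const_mul B) (ae_of_all _ fun y => ?_)
  rw [norm_mul]
  exact mul_le_mul_of_nonneg_right (hB _) (norm_nonneg _)

lemma secondDiff_convol (hv : Continuous v) (hB : ∀ x, |v x| ≤ B) (hg : Integrable g)
    (z x : Euc n) : secondDiff (convol v g) z x = convol v (secondDiff g z) x := by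
  have i := integrable_convol hv hB hg
  unfold convol
  rw [secondDiff, integral_sub_add_integral_sub (i _) (i _) (i _)]
  congr 1; ext y
  have e1 : x + z - y = x - y + z := by abel
  have e2 : x - z - y = x - y - z := by abel
  simp only [secondDiff, e1, e2]
  ring

lemma IsL1Regular.integrable_secondDiff (hg : IsL1Regular g) (z : Euc n) :
    Integrable (secondDiff g z) :=
  (hg.integrable.sub (hg.integrable.comp_add_right z)).add
    (hg.integrable.sub (hg.integrable.comp_sub_right z))

/-- Second differences fall on the L¹ factor, and the sup of a convolution is at most the product of
the sup norm and the L¹ norm. -/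
lemma isSupRegular_convol (hv : Continuous v) (hB : ∀ x, |v x| ≤ B) (hg : IsL1Regular g) :
    IsSupRegular (convol v g) := by
  refine ⟨continuous_convol hv hB hg.integrable, ?_⟩
  obtain ⟨C, hC⟩ := hg.bound
  have hB0 : 0 ≤ B := (abs_nonneg _).trans (hB 0)
  refine ⟨B * C, fun z x => ?_⟩
  rw [secondDiff_convol hv hB hg.integrable, mul_assoc]
  refine (abs_convol_le hB (hg.integrable_secondDiff z) x).trans ?_
  refine mul_le_mul_of_nonneg_left ?_ hB0
  rw [integral_norm_eq_lintegral_enorm (hg.integrable_secondDiff z).aestronglyMeasurable]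
  refine ENNReal.toReal_le_of_le_ofReal (mul_nonneg (NNReal.coe_nonneg C) (truncSq_nonneg z)) ?_
  rw [ENNReal.ofReal_mul (NNReal.coe_nonneg C)]
  simpa using hC z

lemma secondDiffLaplacian_convol [NeZero n] (hv : Continuous v) (hB : ∀ x, |v x| ≤ B)
    (hg : IsL1Regular g) (hs0 : 0 < s) (hs1 : s < 1) (x : Euc n) :
    secondDiffLaplacian s (convol v g) x = convol v (secondDiffLaplacian s g) x := by
  have hi : Integrable (fun p : Euc n × Euc n =>
      v p.2 * (secondDiff g p.1 (x - p.2) * fracKernel s p.1)) (volume.prod volume) := by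
    have h0 := hg.integrable_prod hs0 hs1
    have hmp : MeasurePreserving (Prod.map id (fun y : Euc n => x - y) :
        Euc n × Euc n → Euc n × Euc n) (volume.prod volume) (volume.prod volume) :=
      (MeasurePreserving.id _).prod (Measure.measurePreserving_sub_left volume x)
    have h1 := hmp.integrable_comp_of_integrable h0
    refine h1.bdd_mul (f := fun p : Euc n × Euc n => v p.2) (c := B) ?_ (ae_of_all _ fun p => hB _)
    exact (hv.comp continuous_snd).aestronglyMeasurable
  calc secondDiffLaplacian s (convol v g) x
      = ∫ z, ∫ y, v y * (secondDiff g z (x - y) * fracKernel s z) := by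
        unfold secondDiffLaplacian
        congr 1; ext z
        rw [secondDiff_convol hv hB hg.integrable, convol, ← integral_mul_const]
        congr 1; ext y; ring
    _ = ∫ y, ∫ z, v y * (secondDiff g z (x - y) * fracKernel s z) := integral_integral_swap hi
    _ = _ := by
        unfold convol secondDiffLaplacian
        congr 1; ext y
        rw [integral_const_mul]

end Convol

end FracObstacle

/-! ### Fourier symbols, and the factorization of the Laplacian. -/

namespace FracObstacle

open scoped FourierTransform RealInnerProductSpace Laplacian

variable {n : ℕ} {s : ℝ}

/-- The Fourier symbol `∫ (2 - 2 cos (2π z·ξ)) |z|^{-(n+2s)} dz` of `secondDiffLaplacian s`. -/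
noncomputable def fracSymbol {n : ℕ} (s : ℝ) (ξ : Euc n) : ℝ :=
  ∫ z, (2 - 2 * Real.cos (2 * Real.pi * ⟪z, ξ⟫)) * fracKernel s z

lemma fracKernel_smul {a : ℝ} (ha : 0 < a) (z : Euc n) :
    fracKernel s (a • z) = (a ^ ((n : ℝ) + 2 * s))⁻¹ * fracKernel s z := by
  unfold fracKernel
  rw [norm_smul, Real.norm_of_nonneg ha.le, Real.mul_rpow ha.le (norm_nonneg _), mul_inv]

lemma fracSymbol_smul {a : ℝ} (ha : 0 < a) (ξ : Euc n) :
    fracSymbol s (a • ξ) = a ^ (2 * s) * fracSymbol s ξ := by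
  have h := Measure.integral_comp_smul (volume : Measure (Euc n))
    (fun z => (2 - 2 * Real.cos (2 * Real.pi * ⟪z, ξ⟫)) * fracKernel s z) a
  have hfr : Module.finrank ℝ (Euc n) = n := by simp
  rw [hfr, abs_of_pos (by positivity), smul_eq_mul] at h
  unfold fracSymbol
  have e : a ^ (2 * s) = a ^ ((n : ℝ) + 2 * s) * (a ^ n)⁻¹ := by
    rw [← Real.rpow_natCast, ← Real.rpow_neg ha.le, ← Real.rpow_add ha]
    congr 1; ring
  rw [e, mul_assoc, ← h, ← integral_const_mul]
  congr 1; ext z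
  have hne : a ^ ((n : ℝ) + 2 * s) ≠ 0 := by positivity
  rw [fracKernel_smul ha, real_inner_smul_left, real_inner_smul_right]
  field_simp

/-- The reflection exchanging ξ and η preserves the measure, the kernel and inner products. -/
lemma fracSymbol_eq_of_norm_eq {ξ η : Euc n} (h : ‖ξ‖ = ‖η‖) :
    fracSymbol s ξ = fracSymbol s η := by
  set R := (ℝ ∙ (ξ - η))ᗮ.reflection
  have hR : R ξ = η := Submodule.reflection_sub h
  unfold fracSymbol
  rw [← R.measurePreserving.integral_comp R.toHomeomorph.measurableEmbedding
    (fun z => (2 - 2 * Real.cos (2 * Real.pi * ⟪z, η⟫)) * fracKernel s z)]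
  congr 1; ext z
  rw [← hR]
  simp only [fracKernel, LinearIsometryEquiv.norm_map, LinearIsometryEquiv.inner_map_map]

lemma fracSymbol_nonneg (ξ : Euc n) : 0 ≤ fracSymbol s ξ :=
  integral_nonneg fun z => mul_nonneg (by linarith [Real.cos_le_one (2 * Real.pi * ⟪z, ξ⟫)])
    (fracKernel_nonneg z)

/-- Radial symmetry together with homogeneity of degree 2s. Positivity of κ is never required. -/
lemma exists_fracSymbol_eq [NeZero n] (hs0 : 0 < s) :
    ∃ κ : ℝ, 0 ≤ κ ∧ ∀ ξ : Euc n, fracSymbol s ξ = κ * ‖ξ‖ ^ (2 * s) := by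
  obtain ⟨e, he⟩ : ∃ e : Euc n, ‖e‖ = 1 := exists_norm_eq (Euc n) zero_le_one
  refine ⟨fracSymbol s e, fracSymbol_nonneg e, fun ξ => ?_⟩
  by_cases hξ : ξ = 0
  · rw [hξ, norm_zero, Real.zero_rpow (by linarith), mul_zero]
    simp [fracSymbol]
  · have hpos : 0 < ‖ξ‖ := norm_pos_iff.2 hξ
    rw [fracSymbol_eq_of_norm_eq (ξ := ξ) (η := ‖ξ‖ • e) (by simp [norm_smul, he]),
      fracSymbol_smul hpos, mul_comm]

lemma fourier_ofReal_secondDiff {g : Euc n → ℝ} (hg : Integrable g) (z ξ : Euc n) :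
    𝓕 (fun x => ((secondDiff g z x : ℝ) : ℂ)) ξ =
      ((2 - 2 * Real.cos (2 * Real.pi * ⟪z, ξ⟫) : ℝ) : ℂ) * 𝓕 (fun x => (g x : ℂ)) ξ := by
  have hg' : Integrable (fun x => (g x : ℂ)) := hg.ofReal
  have tr : ∀ w : Euc n, 𝓕 (fun x => (g (x + w) : ℂ)) ξ =
      Complex.exp (2 * Real.pi * ⟪w, ξ⟫ * Complex.I) * 𝓕 (fun x => (g x : ℂ)) ξ := by
    intro w
    have := congrFun (VectorFourier.fourierIntegral_comp_add_right Real.fourierChar volume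
      (innerₗ (Euc n)) (fun x => (g x : ℂ)) w) ξ
    simp only [Real.fourier_eq, VectorFourier.fourierIntegral, innerₗ_apply_apply] at this ⊢
    refine this.trans ?_
    rw [Circle.smul_def, Real.fourierChar_apply, smul_eq_mul]
    push_cast
    rfl
  have ig : ∀ w : Euc n, Integrable (fun x => Real.fourierChar (-⟪x, ξ⟫) • (g (x + w) : ℂ)) :=
    fun w => (Real.fourierIntegral_convergent_iff ξ).2 (hg'.comp_add_right w)
  have i0 := ig 0
  simp only [add_zero] at i0
  have lin : 𝓕 (fun x => ((secondDiff g z x : ℝ) : ℂ)) ξ =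
      (𝓕 (fun x => (g x : ℂ)) ξ - 𝓕 (fun x => (g (x + z) : ℂ)) ξ) +
      (𝓕 (fun x => (g x : ℂ)) ξ - 𝓕 (fun x => (g (x + -z) : ℂ)) ξ) := by
    simp only [Real.fourier_eq]
    rw [integral_sub_add_integral_sub i0 (ig z) (ig (-z))]
    congr 1; ext x
    simp only [secondDiff, ← sub_eq_add_neg]
    push_cast
    rw [smul_add, smul_sub, smul_sub]
  rw [lin, tr, tr]
  push_cast
  rw [Complex.cos, inner_neg_left]
  push_cast
  ring_nf

lemma fourier_ofReal_secondDiffLaplacian [NeZero n] {g : Euc n → ℝ} (hg : IsL1Regular g)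
    (hs0 : 0 < s) (hs1 : s < 1) (ξ : Euc n) :
    𝓕 (fun x => ((secondDiffLaplacian s g x : ℝ) : ℂ)) ξ =
      (fracSymbol s ξ : ℂ) * 𝓕 (fun x => (g x : ℂ)) ξ := by
  have hi := (hg.integrable_prod hs0 hs1).ofReal (𝕜 := ℂ)
  have hi' : Integrable (fun p : Euc n × Euc n => Complex.exp (↑(-2 * Real.pi * ⟪p.2, ξ⟫) * Complex.I) *
      ((secondDiff g p.1 p.2 * fracKernel s p.1 : ℝ) : ℂ)) (volume.prod volume) := by
    refine hi.bdd_mul (c := 1) ?_ (ae_of_all _ fun p => (Complex.norm_exp_ofReal_mul_I _).le)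
    have : Continuous fun p : Euc n × Euc n => Complex.exp (↑(-2 * Real.pi * ⟪p.2, ξ⟫) * Complex.I) := by fun_prop
    exact this.aestronglyMeasurable
  calc 𝓕 (fun x => ((secondDiffLaplacian s g x : ℝ) : ℂ)) ξ
      = ∫ x, ∫ z, Complex.exp (↑(-2 * Real.pi * ⟪x, ξ⟫) * Complex.I) *
          ((secondDiff g z x * fracKernel s z : ℝ) : ℂ) := by
        rw [Real.fourier_eq']
        congr 1; ext x
        rw [integral_const_mul, smul_eq_mul, secondDiffLaplacian,
          integral_complex_ofReal]
    _ = ∫ z, ∫ x, Complex.exp (↑(-2 * Real.pi * ⟪x, ξ⟫) * Complex.I) *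
          ((secondDiff g z x * fracKernel s z : ℝ) : ℂ) := (integral_integral_swap hi').symm
    _ = ∫ z, (fracKernel s z : ℂ) * 𝓕 (fun x => ((secondDiff g z x : ℝ) : ℂ)) ξ := by
        congr 1; ext z
        rw [Real.fourier_eq', ← integral_const_mul]
        congr 1; ext x
        rw [smul_eq_mul]
        push_cast
        ring
    _ = _ := by
        rw [fracSymbol, ← integral_complex_ofReal, ← integral_mul_const]
        congr 1; ext z
        rw [fourier_ofReal_secondDiff hg.integrable]
        push_cast
        ring

/-- By duality: each test function is the Fourier transform of a Schwartz function, and the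
transform can be moved onto `h` inside the pairing. -/
lemma ae_eq_zero_of_fourier_eq_zero {h : Euc n → ℂ} (hi : Integrable h) (h0 : ∀ ξ, 𝓕 h ξ = 0) :
    h =ᵐ[volume] 0 := by
  refine ae_eq_zero_of_integral_contDiff_smul_eq_zero hi.locallyIntegrable fun g hg hgc => ?_
  have hgC : ContDiff ℝ ∞ (fun x => (g x : ℂ)) := Complex.ofRealCLM.contDiff.comp hg
  have hgCc : HasCompactSupport (fun x => (g x : ℂ)) :=
    hgc.comp_left (g := fun t : ℝ => (t : ℂ)) (by simp)
  set G : SchwartzMap (Euc n) ℂ := hgCc.toSchwartzMap hgC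
  set H : SchwartzMap (Euc n) ℂ := 𝓕⁻ G with hH
  have key := VectorFourier.integral_fourierIntegral_smul_eq_flip (L := innerₗ (Euc n))
      Real.continuous_fourierChar continuous_inner
      (H.integrable (μ := volume)) hi
  have e1 : 𝓕 H = G := FourierTransform.fourier_fourierInv_eq G
  have e2 : ∀ x, VectorFourier.fourierIntegral Real.fourierChar volume (innerₗ (Euc n)) H x
      = g x := by
    intro x
    have := congrArg (fun S : SchwartzMap (Euc n) ℂ => S x) e1
    exact this
  have e3 : ∀ x, VectorFourier.fourierIntegral Real.fourierChar volume (innerₗ (Euc n)).flip h x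
      = 0 := by
    intro x
    rw [flip_innerₗ]
    exact h0 x
  simp only [e2, e3, smul_zero, integral_zero] at key
  simpa using key

lemma laplacian_ofReal {ρ : Euc n → ℝ} (hρ : IsTestFunction ρ) (x : Euc n) :
    Δ (fun x => (ρ x : ℂ)) x = (Δ ρ x : ℂ) := by
  have := (hρ.contDiff_two.contDiffAt (x := x)).laplacian_CLM_comp_left (l := Complex.ofRealCLM)
  exact this

lemma fourier_ofReal_laplacian {ρ : Euc n → ℝ} (hρ : IsTestFunction ρ) (ξ : Euc n) :
    𝓕 (fun x => ((Δ ρ x : ℝ) : ℂ)) ξ =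
      -((2 * Real.pi) ^ 2 * ‖ξ‖ ^ 2 : ℝ) * 𝓕 (fun x => (ρ x : ℂ)) ξ := by
  have hgC : ContDiff ℝ ∞ (fun x => (ρ x : ℂ)) := Complex.ofRealCLM.contDiff.comp hρ.contDiff
  have hgCc : HasCompactSupport (fun x => (ρ x : ℂ)) :=
    hρ.compact.comp_left (g := fun t : ℝ => (t : ℂ)) (by simp)
  set G := hgCc.toSchwartzMap hgC with hG
  have e1 : (fun x => ((Δ ρ x : ℝ) : ℂ)) = Δ G := by
    ext x
    rw [SchwartzMap.laplacian_apply, ← laplacian_ofReal hρ]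
    rfl
  have e2 := SchwartzMap.laplacian_eq_fourierMultiplierCLM G
  have e3 : 𝓕 (Δ G) = -(2 * Real.pi) ^ 2 •
      SchwartzMap.smulLeftCLM ℂ (fun x : Euc n => ‖x‖ ^ 2) (𝓕 G) := by
    rw [e2, SchwartzMap.fourierMultiplierCLM_apply, FourierTransform.fourier_smul,
      FourierTransform.fourier_fourierInv_eq]
  have e4 := congrArg (fun S : SchwartzMap (Euc n) ℂ => S ξ) e3
  rw [e1]
  refine e4.trans ?_
  have : (fun x : Euc n => ‖x‖ ^ 2).HasTemperateGrowth := by fun_prop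
  simp only [smul_apply, SchwartzMap.smulLeftCLM_apply_apply this]
  have e5 : (𝓕 G) ξ = 𝓕 (fun x => (ρ x : ℂ)) ξ := rfl
  rw [e5]
  simp only [Complex.real_smul]
  push_cast
  ring

lemma IsTestFunction.integrable_laplacian {ρ : Euc n → ℝ} (hρ : IsTestFunction ρ) :
    Integrable (Δ ρ) := by
  have : Δ ρ = Δ (hρ.compact.toSchwartzMap hρ.contDiff) := by
    ext x
    rw [SchwartzMap.laplacian_apply]
    rfl
  rw [this]
  exact (Δ (hρ.compact.toSchwartzMap hρ.contDiff)).integrable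

/-- The composition of the operators of orders `2s` and `2(1-s)` is a multiple of `-Δ`. -/
lemma exists_secondDiffLaplacian_comp_eq [NeZero n] (hs0 : 0 < s) (hs1 : s < 1) :
    ∃ A : ℝ, 0 ≤ A ∧ ∀ ρ : Euc n → ℝ, IsTestFunction ρ →
      secondDiffLaplacian (1 - s) (secondDiffLaplacian s ρ) =ᵐ[volume] fun x => -(A * Δ ρ x) := by
  obtain ⟨κ, hκ, h⟩ := exists_fracSymbol_eq (n := n) hs0
  obtain ⟨κ', hκ', h'⟩ := exists_fracSymbol_eq (n := n) (s := 1 - s) (by linarith)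
  refine ⟨κ * κ' / (2 * Real.pi) ^ 2, by positivity, fun ρ hρ => ?_⟩
  set A := κ * κ' / (2 * Real.pi) ^ 2 with hA
  have hL := hρ.isL1Regular_secondDiffLaplacian hs0 hs1
  have hs0' : 0 < 1 - s := by linarith
  have hs1' : 1 - s < 1 := by linarith
  have i1 := hL.integrable_secondDiffLaplacian hs0' hs1'
  have i2 := hρ.integrable_laplacian
  have i1' := i1.ofReal (𝕜 := ℂ)
  have i2' := (i2.ofReal (𝕜 := ℂ)).const_mul (A : ℂ)
  have key := ae_eq_zero_of_fourier_eq_zero (i1'.add i2') (fun ξ => by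
    have c1 := (Real.fourierIntegral_convergent_iff ξ).2 i1'
    have c2 := (Real.fourierIntegral_convergent_iff ξ).2 (i2.ofReal (𝕜 := ℂ))
    have f1 := fourier_ofReal_secondDiffLaplacian hL hs0' hs1' ξ
    rw [fourier_ofReal_secondDiffLaplacian hρ.isL1Regular hs0 hs1 ξ, h, h'] at f1
    have f2 := fourier_ofReal_laplacian hρ ξ
    rw [Real.fourier_eq] at f1 f2 ⊢
    have : ∀ x, Real.fourierChar (-⟪x, ξ⟫) • ((fun x =>
        ((secondDiffLaplacian (1 - s) (secondDiffLaplacian s ρ) x : ℝ) : ℂ)) +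
          fun x => (A : ℂ) * ((Δ ρ x : ℝ) : ℂ)) x =
        Real.fourierChar (-⟪x, ξ⟫) •
          ((secondDiffLaplacian (1 - s) (secondDiffLaplacian s ρ) x : ℝ) : ℂ) +
        (A : ℂ) * (Real.fourierChar (-⟪x, ξ⟫) • ((Δ ρ x : ℝ) : ℂ)) := by
      intro x
      simp only [Pi.add_apply, Circle.smul_def, smul_eq_mul]
      ring
    simp only [RCLike.ofReal_eq_complex_ofReal] at *
    simp_rw [this]
    rw [integral_add c1 (c2.const_mul _), integral_const_mul, f1, f2]
    have e : ‖ξ‖ ^ (2 * (1 - s)) * ‖ξ‖ ^ (2 * s) = ‖ξ‖ ^ 2 := by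
      by_cases hξ : ξ = 0
      · rw [hξ, norm_zero, Real.zero_rpow (by linarith), Real.zero_rpow (by linarith)]; simp
      · rw [← Real.rpow_add (norm_pos_iff.2 hξ), ← Real.rpow_natCast]
        congr 1; push_cast; ring
    rw [← e, hA]
    have hpi : (Real.pi : ℂ) ≠ 0 := by exact_mod_cast Real.pi_ne_zero
    push_cast
    field_simp
    ring)
  filter_upwards [key] with x hx
  have hx' : (((secondDiffLaplacian (1 - s) (secondDiffLaplacian s ρ) x + A * Δ ρ x : ℝ)) : ℂ)
      = 0 := by
    push_cast
    exact hx
  have := Complex.ofReal_eq_zero.1 hx'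
  linarith

end FracObstacle

/-! ### From the principal value and distributional formulation to convolutions. -/

namespace FracObstacle

variable {n : ℕ} {s : ℝ}

section PrincipalValue

lemma fracConst_pos (hs0 : 0 < s) (hs1 : s < 1) : 0 < fracConst n s := by
  have h1 : 0 < Real.Gamma ((n : ℝ) / 2 + s) := Real.Gamma_pos_of_pos (by positivity)
  have h2 : 0 < Real.Gamma (1 - s) := Real.Gamma_pos_of_pos (by linarith)
  unfold fracConst
  positivity

lemma measurableSet_lt_norm (ε : ℝ) : MeasurableSet {z : Euc n | ε < ‖z‖} :=
  measurableSet_lt measurable_const measurable_norm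

lemma integrableOn_fracKernel [NeZero n] (hs0 : 0 < s) (hs1 : s < 1) {ε : ℝ} (hε : 0 < ε) :
    IntegrableOn (fracKernel s) {z : Euc n | ε < ‖z‖} := by
  have hm : 0 < min 1 (ε ^ 2) := by positivity
  refine (((integrable_truncSq_mul_fracKernel hs0 hs1).const_mul
    (min 1 (ε ^ 2))⁻¹).integrableOn).mono' (by fun_prop) ?_
  refine (ae_restrict_iff' (measurableSet_lt_norm ε)).2 (ae_of_all _ fun z hz => ?_)
  have hz' : ε < ‖z‖ := hz
  rw [Real.norm_of_nonneg (fracKernel_nonneg z), ← mul_assoc]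
  have : 1 ≤ (min 1 (ε ^ 2))⁻¹ * truncSq z := by
    rw [inv_mul_eq_div, one_le_div hm, truncSq]
    gcongr
  nlinarith [fracKernel_nonneg (s := s) z]

/-- The truncated domain and the kernel are even, so the integrand can be averaged with its image
under z ↦ -z. -/
lemma setIntegral_difference_eq [NeZero n] {f : Euc n → ℝ} (hf : Continuous f) {B : ℝ}
    (hB : ∀ x, ‖f x‖ ≤ B) (hs0 : 0 < s) (hs1 : s < 1) (x : Euc n) {ε : ℝ} (hε : 0 < ε) :
    ∫ z in {z : Euc n | ε < ‖z‖}, (f x - f (x + z)) / ‖z‖ ^ ((n : ℝ) + 2 * s) =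
      2⁻¹ * ∫ z in {z : Euc n | ε < ‖z‖}, secondDiff f z x * fracKernel s z := by
  have hint : ∀ τ : Euc n → Euc n, Continuous τ → IntegrableOn
      (fun z => (f x - f (τ z)) * fracKernel s z) {z : Euc n | ε < ‖z‖} := by
    intro τ hτ
    refine Integrable.bdd_mul (c := B + B) (integrableOn_fracKernel hs0 hs1 hε) ?_
      (ae_of_all _ fun z => (norm_sub_le _ _).trans (add_le_add (hB _) (hB _)))
    exact (by fun_prop : Continuous fun z => f x - f (τ z)).aestronglyMeasurable
  have e : ∫ z in {z : Euc n | ε < ‖z‖}, (f x - f (x - z)) * fracKernel s z =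
      ∫ z in {z : Euc n | ε < ‖z‖}, (f x - f (x + z)) * fracKernel s z := by
    rw [← integral_indicator (measurableSet_lt_norm ε),
      ← integral_indicator (measurableSet_lt_norm ε), ← integral_neg_eq_self]
    congr 1; ext z
    simp [indicator, fracKernel]
  have e2 : ∫ z in {z : Euc n | ε < ‖z‖}, secondDiff f z x * fracKernel s z =
      (∫ z in {z : Euc n | ε < ‖z‖}, (f x - f (x + z)) * fracKernel s z) +
      ∫ z in {z : Euc n | ε < ‖z‖}, (f x - f (x - z)) * fracKernel s z := by
    rw [← integral_add (hint (fun z => x + z) (by fun_prop)) (hint (fun z => x - z) (by fun_prop))]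
    congr 1; ext z
    rw [secondDiff, add_mul]
  rw [e2, e]
  simp only [div_eq_mul_inv]
  change (∫ z in {z : Euc n | ε < ‖z‖}, (f x - f (x + z)) * fracKernel s z) = _
  ring

/-- After symmetrization the integrand is absolutely integrable on the whole space, so dominated
convergence removes the truncation. -/
lemma fracLaplacian_eq [NeZero n] {f : Euc n → ℝ} (hf : IsTestFunction f) (hs0 : 0 < s)
    (hs1 : s < 1) (x : Euc n) :
    fracLaplacian s f x = fracConst n s / 2 * secondDiffLaplacian s f x := by
  obtain ⟨B, hB⟩ := hf.exists_bound
  have hi := hf.isSupRegular.integrable hs0 hs1 x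
  have lim : Tendsto (fun ε : ℝ => ∫ z in {z : Euc n | ε < ‖z‖},
      secondDiff f z x * fracKernel s z) (𝓝[>] 0) (𝓝 (secondDiffLaplacian s f x)) := by
    simp_rw [← integral_indicator (measurableSet_lt_norm _)]
    refine tendsto_integral_filter_of_dominated_convergence
      (fun z => ‖secondDiff f z x * fracKernel s z‖) ?_ ?_ hi.norm ?_
    · exact Eventually.of_forall fun ε =>
        (hi.indicator (measurableSet_lt_norm ε)).aestronglyMeasurable
    · exact Eventually.of_forall fun ε => ae_of_all _ fun z => norm_indicator_le_norm_self _ _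
    · refine ae_of_all _ fun z => ?_
      by_cases hz : z = 0
      · have : ∀ ε : ℝ, indicator {z : Euc n | ε < ‖z‖}
            (fun z => secondDiff f z x * fracKernel s z) z = 0 := by
          intro ε
          simp [hz, indicator, secondDiff]
        simp only [this]
        simp [hz, secondDiff]
      · refine tendsto_const_nhds.congr' ?_
        filter_upwards [Ioo_mem_nhdsGT (norm_pos_iff.2 hz)] with ε hε
        rw [indicator_of_mem (show z ∈ {z : Euc n | ε < ‖z‖} from hε.2)]
  have lim2 : Tendsto (fun ε : ℝ => ∫ z in {z : Euc n | ε < ‖z‖},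
      (f x - f (x + z)) / ‖z‖ ^ ((n : ℝ) + 2 * s)) (𝓝[>] 0)
      (𝓝 (2⁻¹ * secondDiffLaplacian s f x)) := by
    refine (lim.const_mul 2⁻¹).congr' ?_
    filter_upwards [self_mem_nhdsWithin] with ε hε
    exact (setIntegral_difference_eq hf.continuous hB hs0 hs1 x hε).symm
  rw [fracLaplacian, lim2.limUnder_eq]
  ring

lemma IsTestFunction.reflect {ρ : Euc n → ℝ} (hρ : IsTestFunction ρ) (x : Euc n) :
    IsTestFunction (fun y => ρ (x - y)) :=
  ⟨hρ.contDiff.comp (contDiff_const.sub contDiff_id),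
    hρ.compact.comp_homeomorph (Homeomorph.subLeft x)⟩

lemma secondDiffLaplacian_reflect (ρ : Euc n → ℝ) (x y : Euc n) :
    secondDiffLaplacian s (fun y => ρ (x - y)) y = secondDiffLaplacian s ρ (x - y) := by
  unfold secondDiffLaplacian
  congr 1; ext z
  have e1 : x - (y + z) = x - y - z := by abel
  have e2 : x - (y - z) = x - y + z := by abel
  simp only [secondDiff, e1, e2]
  ring

lemma integral_mul_fracLaplacian_reflect [NeZero n] (u : Euc n → ℝ) {ρ : Euc n → ℝ}
    (hρ : IsTestFunction ρ) (hs0 : 0 < s) (hs1 : s < 1) (x : Euc n) :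
    ∫ y, u y * fracLaplacian s (fun y => ρ (x - y)) y =
      fracConst n s / 2 * convol u (secondDiffLaplacian s ρ) x := by
  rw [convol, ← integral_const_mul]
  congr 1; ext y
  rw [fracLaplacian_eq (hρ.reflect x) hs0 hs1, secondDiffLaplacian_reflect]
  ring

/-- The distributional inequality is tested with y ↦ ρ(x - y). -/
lemma FracSuperharmonic.convol_nonneg [NeZero n] {u ρ : Euc n → ℝ} (hu : FracSuperharmonic s u)
    (hρ : IsTestFunction ρ) (h0 : ∀ x, 0 ≤ ρ x) (hs0 : 0 < s) (hs1 : s < 1) (x : Euc n) :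
    0 ≤ convol u (secondDiffLaplacian s ρ) x := by
  have h := hu _ (hρ.reflect x).contDiff (hρ.reflect x).compact (fun y => h0 _)
  rw [integral_mul_fracLaplacian_reflect u hρ hs0 hs1] at h
  have := fracConst_pos (n := n) hs0 hs1
  exact nonneg_of_mul_nonneg_right h (by linarith)

lemma FracHarmonicOn.convol_eq_zero [NeZero n] {u ρ : Euc n → ℝ} {U : Set (Euc n)}
    (hu : FracHarmonicOn s u U) (hρ : IsTestFunction ρ) {ε : ℝ} (h0 : ∀ x, ε ≤ ‖x‖ → ρ x = 0)
    (hs0 : 0 < s) (hs1 : s < 1) {x : Euc n} (hx : Metric.closedBall x ε ⊆ U) :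
    convol u (secondDiffLaplacian s ρ) x = 0 := by
  have hts : tsupport (fun y => ρ (x - y)) ⊆ U := by
    refine (closure_minimal (fun y hy => ?_) Metric.isClosed_closedBall).trans hx
    rw [mem_closedBall_iff_norm']
    by_contra hlt
    exact hy (h0 _ (not_le.1 hlt).le)
  have h := hu _ (hρ.reflect x).contDiff (hρ.reflect x).compact hts
  rw [integral_mul_fracLaplacian_reflect u hρ hs0 hs1] at h
  have := fracConst_pos (n := n) hs0 hs1
  rcases mul_eq_zero.1 h with h | h
  · linarith
  · exact h

end PrincipalValue

/-! ### Mollifiers, behaviour at infinity, and conservation of mass. -/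

section Convolution

variable {u ρ g : Euc n → ℝ} {B ε : ℝ}

/-- Nonnegative smooth functions of integral one supported in the ball of radius `ε`. -/
structure IsMollifier {n : ℕ} (ε : ℝ) (ρ : Euc n → ℝ) : Prop where
  test : IsTestFunction ρ
  nonneg : ∀ x, 0 ≤ ρ x
  integral_eq : ∫ x, ρ x = 1
  eq_zero : ∀ x, ε ≤ ‖x‖ → ρ x = 0

lemma exists_isMollifier (n : ℕ) {ε : ℝ} (hε : 0 < ε) : ∃ ρ : Euc n → ℝ, IsMollifier ε ρ := by
  let b : ContDiffBump (0 : Euc n) := ⟨ε / 2, ε, by linarith, by linarith⟩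
  refine ⟨b.normed volume, ⟨b.contDiff_normed, b.hasCompactSupport_normed⟩,
    fun x => b.nonneg_normed x, b.integral_normed, fun x hx => ?_⟩
  rw [← Function.notMem_support, b.support_normed_eq]
  simpa using hx

lemma IsMollifier.integral_sub_left (hρ : IsMollifier ε ρ) (x : Euc n) :
    ∫ y, ρ (x - y) = 1 := by
  rw [integral_sub_left_eq_self ρ volume x, hρ.integral_eq]

lemma IsMollifier.le_convol (hρ : IsMollifier ε ρ) (hu : Continuous u) (hB : ∀ x, |u x| ≤ B)
    {x : Euc n} {a : ℝ} (h : ∀ y, ‖x - y‖ < ε → a ≤ u y) : a ≤ convol u ρ x := by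
  have i := integrable_convol hu hB hρ.test.integrable x
  calc a = ∫ y, a * ρ (x - y) := by rw [integral_const_mul, hρ.integral_sub_left, mul_one]
    _ ≤ convol u ρ x := by
      refine integral_mono ((hρ.test.integrable.comp_sub_left x).const_mul a) i fun y => ?_
      by_cases hy : ‖x - y‖ < ε
      · exact mul_le_mul_of_nonneg_right (h y hy) (hρ.nonneg _)
      · simp [hρ.eq_zero _ (not_lt.1 hy)]

lemma convol_neg_left (u ρ : Euc n → ℝ) (x : Euc n) :
    convol (fun y => -u y) ρ x = -convol u ρ x := by
  simp [convol, integral_neg]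

lemma IsMollifier.convol_le (hρ : IsMollifier ε ρ) (hu : Continuous u) (hB : ∀ x, |u x| ≤ B)
    {x : Euc n} {a : ℝ} (h : ∀ y, ‖x - y‖ < ε → u y ≤ a) : convol u ρ x ≤ a := by
  have := hρ.le_convol (u := fun y => -u y) (x := x) (a := -a) hu.neg (by simpa using hB)
    (fun y hy => neg_le_neg (h y hy))
  rw [convol_neg_left] at this
  linarith

lemma exists_forall_norm_le_of_tendsto_cocompact {v : Euc n → ℝ}
    (hv : Tendsto v (cocompact (Euc n)) (𝓝 0)) {δ : ℝ} (hδ : 0 < δ) :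
    ∃ R : ℝ, ∀ x, R ≤ ‖x‖ → |v x| ≤ δ := by
  have h := hv (Metric.closedBall_mem_nhds 0 hδ)
  rw [mem_map, mem_cocompact] at h
  obtain ⟨K, hK, hKv⟩ := h
  obtain ⟨R, hR⟩ := hK.isBounded.exists_norm_le
  refine ⟨R + 1, fun x hx => ?_⟩
  have : x ∈ Kᶜ := fun hxK => by linarith [hR x hxK]
  simpa using hKv this

lemma tendsto_cocompact_of_forall {v : Euc n → ℝ}
    (h : ∀ δ > 0, ∃ R : ℝ, ∀ x, R ≤ ‖x‖ → |v x| ≤ δ) :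
    Tendsto v (cocompact (Euc n)) (𝓝 0) := by
  refine Metric.nhds_basis_closedBall.tendsto_right_iff.2 fun δ hδ => ?_
  obtain ⟨R, hR⟩ := h δ hδ
  filter_upwards [(isCompact_closedBall (0 : Euc n) R).compl_mem_cocompact] with x hx
  have : R ≤ ‖x‖ := by
    by_contra hlt
    exact hx (by simpa using (not_le.1 hlt).le)
  simpa using hR x this

lemma exists_bound_of_tendsto_cocompact {v : Euc n → ℝ} (hc : Continuous v)
    (hv : Tendsto v (cocompact (Euc n)) (𝓝 0)) : ∃ B, ∀ x, |v x| ≤ B := by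
  obtain ⟨R, hR⟩ := exists_forall_norm_le_of_tendsto_cocompact hv one_pos
  obtain ⟨C, hC⟩ := (isCompact_closedBall (0 : Euc n) R).exists_bound_of_continuousOn
    hc.continuousOn
  refine ⟨max C 1, fun x => ?_⟩
  by_cases hx : R ≤ ‖x‖
  · exact (hR x hx).trans (le_max_right _ _)
  · exact (hC x (by simpa using (not_le.1 hx).le)).trans (le_max_left _ _)

lemma IsMollifier.tendsto_convol (hρ : IsMollifier ε ρ) (hu : Continuous u)
    (h0 : Tendsto u (cocompact (Euc n)) (𝓝 0)) :
    Tendsto (convol u ρ) (cocompact (Euc n)) (𝓝 0) := by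
  obtain ⟨B, hB⟩ := exists_bound_of_tendsto_cocompact hu h0
  refine tendsto_cocompact_of_forall fun δ hδ => ?_
  obtain ⟨R, hR⟩ := exists_forall_norm_le_of_tendsto_cocompact h0 hδ
  refine ⟨R + ε, fun x hx => ?_⟩
  have key : ∀ y, ‖x - y‖ < ε → |u y| ≤ δ := fun y hy => hR y (by
    have := norm_sub_norm_le x y
    linarith)
  exact abs_le.2 ⟨hρ.le_convol hu hB fun y hy => (abs_le.1 (key y hy)).1,
    hρ.convol_le hu hB fun y hy => (abs_le.1 (key y hy)).2⟩

lemma convol_convol_comm (hu : Continuous u) (hB : ∀ x, |u x| ≤ B) (hg : Integrable g)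
    (hρ : Integrable ρ) (x : Euc n) :
    convol (convol u g) ρ x = convol (convol u ρ) g x := by
  have hi : Integrable (fun p : Euc n × Euc n => u (x - p.1 - p.2) * (ρ p.1 * g p.2))
      (volume.prod volume) := by
    refine (hρ.mul_prod hg).bdd_mul (c := B) ?_ (ae_of_all _ fun p => hB _)
    exact (by fun_prop : Continuous fun p : Euc n × Euc n =>
      u (x - p.1 - p.2)).aestronglyMeasurable
  have e : ∀ a b : Euc n → ℝ, convol (convol u a) b x =
      ∫ y, ∫ w, u (x - y - w) * (b y * a w) := by
    intro a b
    rw [convol_eq]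
    congr 1; ext y
    rw [convol_eq, ← integral_mul_const]
    congr 1; ext w
    ring
  rw [e, e, integral_integral_swap hi]
  congr 1; ext w
  congr 1; ext y
  have : x - y - w = x - w - y := by abel
  rw [this]
  ring

lemma integral_convol {f : Euc n → ℝ} (hf : Integrable f) (hρ : Integrable ρ) :
    ∫ x, convol f ρ x = (∫ x, f x) * ∫ x, ρ x :=
  integral_convolution (ContinuousLinearMap.mul ℝ ℝ) hf hρ

/-- Both (u*Lρ)*ρ' and (u*Lρ')*ρ equal L applied to the double mollification of u, and convolving
with a function of integral one preserves the total integral. -/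
lemma integral_convol_secondDiffLaplacian_eq [NeZero n] {ρ' : Euc n → ℝ} {ε' : ℝ}
    (hρ : IsMollifier ε ρ) (hρ' : IsMollifier ε' ρ') (hu : Continuous u) (hB : ∀ x, |u x| ≤ B)
    (hs0 : 0 < s) (hs1 : s < 1)
    (hi : Integrable (convol u (secondDiffLaplacian s ρ)))
    (hi' : Integrable (convol u (secondDiffLaplacian s ρ'))) :
    ∫ x, convol u (secondDiffLaplacian s ρ) x = ∫ x, convol u (secondDiffLaplacian s ρ') x := by
  have key : ∀ {σ τ : Euc n → ℝ}, IsTestFunction σ → IsTestFunction τ →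
      convol (convol u (secondDiffLaplacian s σ)) τ =
        secondDiffLaplacian s (convol (convol u τ) σ) := by
    intro σ τ hσ hτ
    ext x
    have hL := hσ.isL1Regular.integrable_secondDiffLaplacian hs0 hs1
    rw [convol_convol_comm hu hB hL hτ.integrable, secondDiffLaplacian_convol
      (continuous_convol hu hB hτ.integrable) (abs_convol_le hB hτ.integrable)
      hσ.isL1Regular hs0 hs1]
  have sw : convol (convol u ρ') ρ = convol (convol u ρ) ρ' :=
    funext fun x => convol_convol_comm hu hB hρ'.test.integrable hρ.test.integrable x
  have e1 := integral_convol hi hρ'.test.integrable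
  have e2 := integral_convol hi' hρ.test.integrable
  rw [key hρ.test hρ'.test, hρ'.integral_eq, mul_one, sw] at e1
  rw [key hρ'.test hρ.test, hρ.integral_eq, mul_one] at e2
  rw [← e1, ← e2]

end Convolution

/-! ### The minimum principle for functions vanishing at infinity. -/

section MinimumPrinciple

/-- At a negative global minimum m every second difference is nonpositive, so the sign hypothesis
makes them vanish for almost every z, hence for all z by continuity. Letting z tend to infinity
gives 2v(m) = 0, a contradiction. -/
lemma nonneg_of_secondDiffLaplacian_nonneg [NeZero n] {v : Euc n → ℝ} (hv : IsSupRegular v)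
    (h0 : Tendsto v (cocompact (Euc n)) (𝓝 0)) (hs0 : 0 < s) (hs1 : s < 1)
    (h : ∀ x, v x < 0 → 0 ≤ secondDiffLaplacian s v x) (x : Euc n) : 0 ≤ v x := by
  by_contra! hx
  have hnear : ∀ᶠ y in cocompact (Euc n), v x ≤ v y :=
    (h0.eventually (eventually_gt_nhds hx)).mono fun y hy => hy.le
  obtain ⟨m, hm⟩ := hv.continuous.exists_forall_le' x hnear
  have hm0 : v m < 0 := (hm x).trans_lt hx
  have hle : ∀ z, secondDiff v z m * fracKernel s z ≤ 0 := fun z => by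
    refine mul_nonpos_of_nonpos_of_nonneg ?_ (fracKernel_nonneg z)
    have := hm (m + z)
    have := hm (m - z)
    unfold secondDiff
    linarith
  have hz : ∫ z, -(secondDiff v z m * fracKernel s z) = 0 := by
    rw [integral_neg, neg_eq_zero]
    exact le_antisymm (integral_nonpos hle) (h m hm0)
  rw [integral_eq_zero_iff_of_nonneg (fun z => neg_nonneg.2 (hle z))
    (hv.integrable hs0 hs1 m).neg] at hz
  have hae : (fun z => secondDiff v z m) =ᵐ[volume] fun _ => 0 := by
    have h0ae : ∀ᵐ z : Euc n, z ≠ 0 := by simp [ae_iff]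
    filter_upwards [hz, h0ae] with z hz hz0
    have := (fracKernel_pos (s := s) hz0).ne'
    have hz' : -(secondDiff v z m * fracKernel s z) = 0 := hz
    exact (mul_eq_zero.1 (neg_eq_zero.1 hz')).resolve_right this
  have hc := hv.continuous
  have hcd : Continuous fun z => secondDiff v z m := by unfold secondDiff; fun_prop
  have hall := hcd.ae_eq_iff_eq volume continuous_const |>.1 hae
  have l1 : Tendsto (fun z => v (m + z)) (cocompact (Euc n)) (𝓝 0) :=
    h0.comp (Homeomorph.addLeft m).isClosedEmbedding.tendsto_cocompact
  have l2 : Tendsto (fun z => v (m - z)) (cocompact (Euc n)) (𝓝 0) :=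
    h0.comp (Homeomorph.subLeft m).isClosedEmbedding.tendsto_cocompact
  have l3 : Tendsto (fun z => secondDiff v z m) (cocompact (Euc n))
      (𝓝 ((v m - 0) + (v m - 0))) :=
    (l1.const_sub _).add (l2.const_sub _)
  rw [hall] at l3
  have := tendsto_nhds_unique l3 tendsto_const_nhds
  linarith

end MinimumPrinciple

end FracObstacle

/-! ### The classical Laplacian: mollification, local maxima, the paraboloid. -/

namespace FracObstacle

open scoped RealInnerProductSpace Laplacian

variable {n : ℕ} {s : ℝ}

lemma laplacian_eq_sum_fderiv {f : Euc n → ℝ} (hf : ContDiff ℝ 2 f) (x : Euc n) :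
    Δ f x = ∑ i, fderiv ℝ (fun y => fderiv ℝ f y (stdOrthonormalBasis ℝ (Euc n) i)) x
      (stdOrthonormalBasis ℝ (Euc n) i) := by
  rw [InnerProductSpace.laplacian_eq_iteratedFDeriv_stdOrthonormalBasis]
  refine Finset.sum_congr rfl fun i _ => ?_
  have hd : DifferentiableAt ℝ (fderiv ℝ f) x :=
    (hf.fderiv_right (m := 1) (by norm_num)).differentiable one_ne_zero x
  rw [iteratedFDeriv_two_apply, fderiv_clm_apply hd (by fun_prop)]
  simp

lemma IsTestFunction.fderiv_apply {ρ : Euc n → ℝ} (hρ : IsTestFunction ρ) (v : Euc n) :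
    IsTestFunction (fun y => _root_.fderiv ℝ ρ y v) :=
  ⟨hρ.fderiv.contDiff.clm_apply contDiff_const,
    hρ.fderiv.compact.comp_left (g := fun L : Euc n →L[ℝ] ℝ => L v) rfl⟩

section

variable {u ρ : Euc n → ℝ} {B : ℝ}

lemma contDiff_convol (hu : Continuous u) (hρ : IsTestFunction ρ) :
    ContDiff ℝ 2 (convol u ρ) :=
  HasCompactSupport.contDiff_convolution_right (n := 2) (ContinuousLinearMap.mul ℝ ℝ)
    hρ.compact hu.locallyIntegrable hρ.contDiff_two

lemma fderiv_convol_apply (hu : Continuous u) (hB : ∀ x, |u x| ≤ B) (hρ : IsTestFunction ρ)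
    (x v : Euc n) :
    fderiv ℝ (convol u ρ) x v = convol u (fun y => fderiv ℝ ρ y v) x := by
  have h := HasCompactSupport.hasFDerivAt_convolution_right (ContinuousLinearMap.mul ℝ ℝ)
    hρ.compact (hu.locallyIntegrable (μ := volume)) (hρ.contDiff.of_le (by simp)) x
  have e : fderiv ℝ (convol u ρ) x = _ := HasFDerivAt.fderiv h
  rw [e, convolution_def, ContinuousLinearMap.integral_apply]
  · rfl
  · have hi : Integrable (fun t => u t • fderiv ℝ ρ (x - t)) :=
      (hρ.fderiv.integrable.comp_sub_left x).bdd_smul B hu.aestronglyMeasurable (ae_of_all _ hB)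
    exact hi

lemma laplacian_convol (hu : Continuous u) (hB : ∀ x, |u x| ≤ B) (hρ : IsTestFunction ρ)
    (x : Euc n) : Δ (convol u ρ) x = convol u (Δ ρ) x := by
  rw [laplacian_eq_sum_fderiv (contDiff_convol hu hρ)]
  have e : ∀ v : Euc n, fderiv ℝ (fun y => fderiv ℝ (convol u ρ) y v) x v =
      convol u (fun y => fderiv ℝ (fun w => fderiv ℝ ρ w v) y v) x := by
    intro v
    rw [← fderiv_convol_apply hu hB (hρ.fderiv_apply v)]
    congr 2; ext y
    exact fderiv_convol_apply hu hB hρ y v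
  simp_rw [e, convol]
  rw [← integral_finsetSum _ fun i _ => integrable_convol hu hB
    ((hρ.fderiv_apply _).fderiv_apply _).integrable x]
  congr 1; ext y
  rw [laplacian_eq_sum_fderiv hρ.contDiff_two, Finset.mul_sum]

end

/-- A positive second derivative would make t a local minimum too, so g would be locally constant
there. -/
lemma deriv_deriv_nonpos_of_isLocalMax {g : ℝ → ℝ} {t : ℝ} (hc : ContinuousAt g t)
    (h : IsLocalMax g t) : deriv (deriv g) t ≤ 0 := by
  by_contra! hpos
  have hmin := isLocalMin_of_deriv_deriv_pos hpos h.deriv_eq_zero hc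
  have hconst : g =ᶠ[𝓝 t] fun _ => g t := by
    filter_upwards [h, hmin] with y h1 h2 using le_antisymm h1 h2
  have : deriv (deriv g) t = 0 := by
    rw [hconst.deriv.deriv_eq]
    simp
  linarith

lemma laplacian_nonpos_of_isLocalMax {f : Euc n → ℝ} (hf : ContDiff ℝ 2 f) {x : Euc n}
    (h : IsLocalMax f x) : Δ f x ≤ 0 := by
  rw [laplacian_eq_sum_fderiv hf]
  refine Finset.sum_nonpos fun i _ => ?_
  set v := stdOrthonormalBasis ℝ (Euc n) i
  have hline : ∀ t : ℝ, HasDerivAt (fun t : ℝ => x + t • v) v t := fun t => by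
    simpa using ((hasDerivAt_id t).smul_const v).const_add x
  have along : ∀ {g : Euc n → ℝ}, Differentiable ℝ g → ∀ t : ℝ,
      deriv (fun t : ℝ => g (x + t • v)) t = fderiv ℝ g (x + t • v) v := fun hg t =>
    ((hg (x + t • v)).hasFDerivAt.comp_hasDerivAt t (hline t)).deriv
  have hd : ContDiff ℝ 1 (fderiv ℝ f) := hf.fderiv_right (by norm_num)
  have hdv : Differentiable ℝ (fun y => fderiv ℝ f y v) :=
    (hd.differentiable one_ne_zero).clm_apply (differentiable_const v)
  have e1 : deriv (fun t : ℝ => f (x + t • v)) = fun t => fderiv ℝ f (x + t • v) v :=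
    funext (along (hf.differentiable (by norm_num)))
  have e2 := along hdv 0
  rw [← e1, zero_smul, add_zero] at e2
  rw [← e2]
  have hcont : ContinuousAt (fun t : ℝ => x + t • v) 0 := (hline 0).continuousAt
  refine deriv_deriv_nonpos_of_isLocalMax ?_ ?_
  · exact (hf.continuous.comp (by fun_prop : Continuous fun t : ℝ => x + t • v)).continuousAt
  · have h' : IsLocalMax f ((fun t : ℝ => x + t • v) 0) := by simpa using h
    exact IsLocalMax.comp_continuous (g := fun t : ℝ => x + t • v) (b := 0) h' hcont

lemma laplacian_norm_sub_sq (c x : Euc n) : Δ (fun y : Euc n => ‖y - c‖ ^ 2) x = 2 * n := by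
  have hf : ContDiff ℝ 2 (fun y : Euc n => ‖y - c‖ ^ 2) :=
    (contDiff_id.sub contDiff_const).norm_sq ℝ
  have e : ∀ y v : Euc n, fderiv ℝ (fun y : Euc n => ‖y - c‖ ^ 2) y v = 2 * ⟪y - c, v⟫ := by
    intro y v
    have : HasFDerivAt (fun y : Euc n => ‖y - c‖ ^ 2) _ y := ((hasFDerivAt_id y).sub_const c).norm_sq
    rw [this.fderiv]
    simp [inner_sub_left]
  have e2 : ∀ v : Euc n, fderiv ℝ (fun y : Euc n => 2 * ⟪y - c, v⟫) x v = 2 * ‖v‖ ^ 2 := by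
    intro v
    have h1 : HasFDerivAt (fun y : Euc n => ⟪v, y - c⟫) (innerSL ℝ v) x :=
      (innerSL ℝ v).hasFDerivAt.comp x ((hasFDerivAt_id x).sub_const c)
    have h2 : (fun y : Euc n => 2 * ⟪y - c, v⟫) = fun y => 2 * ⟪v, y - c⟫ := by
      ext y; rw [real_inner_comm]
    rw [h2, (h1.const_mul 2).fderiv]
    simp
  rw [laplacian_eq_sum_fderiv hf]
  simp_rw [e, e2]
  simp [mul_comm]

end FracObstacle

/-! ### Positivity of u, the lower bound for its Laplacian, and quadratic growth. -/

namespace FracObstacle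

open scoped Laplacian

variable {n : ℕ} {s : ℝ}

/-- At a zero of f only the values of f elsewhere contribute, with a negative sign, and on the
support the kernel is at least R^{-(n+2s)}. This quantifies nonlocality: it serves the barrier in
`FracSuperharmonic.pos` and, with 1 - s for s, the lower bound on the Laplacian. -/
lemma secondDiffLaplacian_le_of_eq_zero [NeZero n] {f : Euc n → ℝ} (hf : IsSupRegular f)
    (h0 : ∀ x, 0 ≤ f x) (hi : Integrable f) (hs0 : 0 < s) (hs1 : s < 1) {x : Euc n}
    (hx : f x = 0) {R : ℝ} (hsupp : ∀ y, f y ≠ 0 → ‖y - x‖ ≤ R) :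
    secondDiffLaplacian s f x ≤ -(2 * (R ^ ((n : ℝ) + 2 * s))⁻¹ * ∫ y, f y) := by
  set k := (R ^ ((n : ℝ) + 2 * s))⁻¹ with hk
  have i1 := hi.comp_add_left x
  have i2 := hi.comp_sub_left x
  have e : -(2 * k * ∫ y, f y) = ∫ z, -((f (x + z) + f (x - z)) * k) := by
    rw [integral_neg, integral_mul_const, integral_add i1 i2,
      integral_add_left_eq_self f x, integral_sub_left_eq_self f volume x]
    ring
  rw [e]
  refine integral_mono (hf.integrable hs0 hs1 x) ((i1.add i2).mul_const k).neg fun z => ?_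
  have key : ∀ w, f w ≠ 0 → ‖w - x‖ = ‖z‖ → k ≤ fracKernel s z := by
    intro w hw hwz
    have hz : 0 < ‖z‖ := by
      rw [← hwz, norm_pos_iff, sub_ne_zero]
      rintro rfl
      exact hw hx
    have hzR : ‖z‖ ≤ R := hwz ▸ hsupp w hw
    have hn : (0 : ℝ) ≤ (n : ℝ) + 2 * s := by positivity
    unfold fracKernel
    rw [hk]
    gcongr
  have h1 : f (x + z) * k ≤ f (x + z) * fracKernel s z := by
    by_cases h : f (x + z) = 0
    · simp [h]
    · exact mul_le_mul_of_nonneg_left (key _ h (by simp)) (h0 _)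
  have h2 : f (x - z) * k ≤ f (x - z) * fracKernel s z := by
    by_cases h : f (x - z) = 0
    · simp [h]
    · exact mul_le_mul_of_nonneg_left (key _ h (by simp)) (h0 _)
  simp only [secondDiff, hx]
  linarith

lemma IsSupRegular.exists_abs_secondDiffLaplacian_le [NeZero n] {v : Euc n → ℝ}
    (hv : IsSupRegular v) (hs0 : 0 < s) (hs1 : s < 1) :
    ∃ M, 0 ≤ M ∧ ∀ x, |secondDiffLaplacian s v x| ≤ M := by
  obtain ⟨C, hC⟩ := hv.bound
  have key : ∀ x, |secondDiffLaplacian s v x| ≤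
      ∫ z : Euc n, C * (truncSq z * fracKernel s z) := fun x => by
    rw [← Real.norm_eq_abs]
    refine norm_integral_le_of_norm_le
      ((integrable_truncSq_mul_fracKernel hs0 hs1).const_mul C) (ae_of_all _ fun z => ?_)
    rw [Real.norm_eq_abs, abs_mul, abs_of_nonneg (fracKernel_nonneg z), ← mul_assoc]
    exact mul_le_mul_of_nonneg_right (hC z x) (fracKernel_nonneg z)
  exact ⟨_, (abs_nonneg _).trans (key 0), key⟩

lemma IsSupRegular.sub_const_mul {v w : Euc n → ℝ} (hv : IsSupRegular v) (hw : IsSupRegular w)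
    (c : ℝ) : IsSupRegular (fun x => v x - c * w x) := by
  obtain ⟨C, hC⟩ := hv.bound
  obtain ⟨D, hD⟩ := hw.bound
  refine ⟨hv.continuous.sub (hw.continuous.const_mul c), C + |c| * D, fun z x => ?_⟩
  have e : secondDiff (fun x => v x - c * w x) z x = secondDiff v z x - c * secondDiff w z x := by
    simp only [secondDiff]; ring
  rw [e, add_mul, mul_assoc]
  refine (abs_sub _ _).trans (add_le_add (hC z x) ?_)
  rw [abs_mul]
  exact mul_le_mul_of_nonneg_left (hD z x) (abs_nonneg c)

lemma secondDiffLaplacian_sub_const_mul [NeZero n] {v w : Euc n → ℝ} (hv : IsSupRegular v)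
    (hw : IsSupRegular w) (c : ℝ) (hs0 : 0 < s) (hs1 : s < 1) (x : Euc n) :
    secondDiffLaplacian s (fun x => v x - c * w x) x =
      secondDiffLaplacian s v x - c * secondDiffLaplacian s w x := by
  unfold secondDiffLaplacian
  rw [← integral_const_mul, ← integral_sub (hv.integrable hs0 hs1 x)
    ((hw.integrable hs0 hs1 x).const_mul c)]
  congr 1; ext z
  simp only [secondDiff]; ring

lemma le_of_forall_isMollifier_le {u : Euc n → ℝ} {B : ℝ} (hu : Continuous u)
    (hB : ∀ x, |u x| ≤ B) {x : Euc n} {a r : ℝ} (hr : 0 < r)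
    (h : ∀ ε, 0 < ε → ε ≤ r → ∀ ρ, IsMollifier ε ρ → a ≤ convol u ρ x) : a ≤ u x := by
  by_contra! hlt
  obtain ⟨δ, hδ, hδu⟩ := Metric.continuous_iff.1 hu x ((a - u x) / 2) (by linarith)
  obtain ⟨ρ, hρ⟩ := exists_isMollifier n (lt_min hδ hr)
  have h1 := h _ (lt_min hδ hr) (min_le_right _ _) ρ hρ
  have h2 : convol u ρ x ≤ (a + u x) / 2 := hρ.convol_le hu hB fun y hy => by
    have := hδu y (by rw [dist_comm, dist_eq_norm]; exact hy.trans_le (min_le_left _ _))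
    rw [Real.dist_eq] at this
    linarith [(abs_lt.1 this).2]
  linarith

section Positivity

variable {u : Euc n → ℝ}

lemma FracSuperharmonic.secondDiffLaplacian_convol_nonneg [NeZero n]
    (hsup : FracSuperharmonic s u) (hu : Continuous u) {B : ℝ} (hB : ∀ x, |u x| ≤ B) {ε : ℝ}
    {ρ : Euc n → ℝ} (hρ : IsMollifier ε ρ) (hs0 : 0 < s) (hs1 : s < 1) (x : Euc n) :
    0 ≤ secondDiffLaplacian s (convol u ρ) x := by
  rw [secondDiffLaplacian_convol hu hB hρ.test.isL1Regular hs0 hs1]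
  exact hsup.convol_nonneg hρ.test hρ.nonneg hs0 hs1 x

lemma FracSuperharmonic.mollified_nonneg [NeZero n] (hsup : FracSuperharmonic s u)
    (hu : Continuous u) (h0 : Tendsto u (cocompact (Euc n)) (𝓝 0)) {ε : ℝ} {ρ : Euc n → ℝ}
    (hρ : IsMollifier ε ρ) (hs0 : 0 < s) (hs1 : s < 1) (x : Euc n) : 0 ≤ convol u ρ x := by
  obtain ⟨B, hB⟩ := exists_bound_of_tendsto_cocompact hu h0
  exact nonneg_of_secondDiffLaplacian_nonneg (isSupRegular_convol hu hB hρ.test.isL1Regular)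
    (hρ.tendsto_convol hu h0) hs0 hs1
    (fun y _ => hsup.secondDiffLaplacian_convol_nonneg hu hB hρ hs0 hs1 y) x

/-- The strong minimum principle for continuous supersolutions vanishing at infinity. -/
lemma FracSuperharmonic.pos [NeZero n] (hsup : FracSuperharmonic s u) (hu : Continuous u)
    (h0 : Tendsto u (cocompact (Euc n)) (𝓝 0)) (hs0 : 0 < s) (hs1 : s < 1) {p : Euc n}
    (hp : 0 < u p) (x₀ : Euc n) : 0 < u x₀ := by
  obtain ⟨B, hB⟩ := exists_bound_of_tendsto_cocompact hu h0
  by_cases hxp : x₀ = p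
  · rwa [hxp]
  have hd : 0 < ‖x₀ - p‖ := norm_pos_iff.2 (sub_ne_zero.2 hxp)
  set d := ‖x₀ - p‖ with hd_def
  obtain ⟨δ, hδ, hδu⟩ := Metric.continuous_iff.1 hu p (u p / 2) (by linarith)
  set c := u p / 2 with hc
  have hc0 : 0 < c := by linarith
  -- The bound 2r ≤ δ keeps mollifications at scale at most r above c on the r-ball about p; 4r ≤ d
  -- separates the two bumps.
  obtain ⟨r, hr, hrδ, hrd⟩ : ∃ r > 0, 2 * r ≤ δ ∧ 4 * r ≤ d :=
    ⟨min (δ / 2) (d / 4), by positivity, by linarith [min_le_left (δ / 2) (d / 4)],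
      by linarith [min_le_right (δ / 2) (d / 4)]⟩
  have hur : ∀ y, ‖y - p‖ < 2 * r → c ≤ u y := fun y hy => by
    have := hδu y (by rw [dist_eq_norm]; linarith)
    rw [Real.dist_eq] at this
    linarith [(abs_lt.1 this).1]
  let bp : ContDiffBump p := ⟨r / 2, r, by linarith, by linarith⟩
  let bx : ContDiffBump x₀ := ⟨r / 2, r, by linarith, by linarith⟩
  have tp : IsTestFunction bp := ⟨bp.contDiff, bp.hasCompactSupport⟩
  have tx : IsTestFunction bx := ⟨bx.contDiff, bx.hasCompactSupport⟩
  have sp : ∀ y, bp y ≠ 0 → ‖y - p‖ < r := fun y hy => by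
    have : y ∈ Function.support bp := hy
    rwa [bp.support_eq, mem_ball_iff_norm] at this
  have sx : ∀ y, bx y ≠ 0 → ‖y - x₀‖ < r := fun y hy => by
    have : y ∈ Function.support bx := hy
    rwa [bx.support_eq, mem_ball_iff_norm] at this
  have hsep : ∀ y, ‖y - x₀‖ < r → bp y = 0 := fun y hy => by
    by_contra h
    have h1 := sp y h
    have h2 : d ≤ ‖y - x₀‖ + ‖y - p‖ := by
      rw [hd_def, norm_sub_rev y x₀]
      exact norm_sub_le_norm_sub_add_norm_sub x₀ y p
    linarith
  -- Points of the two bumps are at distance at most d + 2r ≤ 2d.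
  set m := 2 * ((2 * d) ^ ((n : ℝ) + 2 * s))⁻¹ * ∫ y, bp y with hm
  have hm0 : 0 < m := by
    have := bp.integral_pos (μ := (volume : Measure (Euc n)))
    positivity
  have hLp : ∀ y, ‖y - x₀‖ < r → secondDiffLaplacian s bp y ≤ -m := fun y hy => by
    refine secondDiffLaplacian_le_of_eq_zero tp.isSupRegular (fun _ => bp.nonneg) tp.integrable
      hs0 hs1 (hsep y hy) fun w hw => ?_
    have h1 := sp w hw
    have h2 := norm_sub_le_norm_sub_add_norm_sub w p y
    have h3 := norm_sub_le_norm_sub_add_norm_sub p x₀ y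
    rw [norm_sub_rev p x₀, norm_sub_rev x₀ y] at h3
    linarith
  obtain ⟨M, hM0, hM⟩ := tx.isSupRegular.exists_abs_secondDiffLaplacian_le hs0 hs1
  -- Small enough that the loss at most tM from the bump at x₀ is absorbed by the gain m from the
  -- bump at p; the 1 avoids division by zero.
  set t := m / (M + 1) with ht
  have ht0 : 0 < t := by positivity
  have htM : t * M ≤ m := by
    rw [ht, div_mul_eq_mul_div, div_le_iff₀ (by linarith)]
    nlinarith
  refine (mul_pos hc0 ht0).trans_le (le_of_forall_isMollifier_le hu hB hr ?_)
  intro ε hε hεr ρ hρ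
  have hru := isSupRegular_convol hu hB hρ.test.isL1Regular
  -- The barrier c(bp + t bx) is to lie below u*ρ. Away from the bump at x₀ this is direct, so v can
  -- be negative only where the barrier is a subsolution.
  set v := fun y => (convol u ρ y - c * bp y) - (c * t) * bx y with hv
  have hv1 := hru.sub_const_mul tp.isSupRegular c
  have hvr : IsSupRegular v := hv1.sub_const_mul tx.isSupRegular (c * t)
  have hv0 : Tendsto v (cocompact (Euc n)) (𝓝 0) := by
    have z1 : Tendsto bp (cocompact (Euc n)) (𝓝 0) := tp.compact.is_zero_at_infty
    have z2 : Tendsto bx (cocompact (Euc n)) (𝓝 0) := tx.compact.is_zero_at_infty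
    simpa using ((hρ.tendsto_convol hu h0).sub (z1.const_mul c)).sub (z2.const_mul (c * t))
  have hvn := nonneg_of_secondDiffLaplacian_nonneg hvr hv0 hs0 hs1 (fun y hy => by
    have hne : bx y ≠ 0 := by
      intro hbx
      have hy' : convol u ρ y < c * bp y := by
        simp only [hv, hbx, mul_zero, sub_zero] at hy
        linarith
      by_cases hbp : bp y = 0
      · rw [hbp, mul_zero] at hy'
        linarith [hsup.mollified_nonneg hu h0 hρ hs0 hs1 y]
      · have h1 := sp y hbp
        have h2 : c ≤ convol u ρ y := hρ.le_convol hu hB fun w hw => hur w (by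
          have := norm_sub_le_norm_sub_add_norm_sub w y p
          rw [norm_sub_rev w y] at this
          linarith)
        have h3 : c * bp y ≤ c := mul_le_of_le_one_right hc0.le bp.le_one
        linarith
    have hyx := sx y hne
    rw [secondDiffLaplacian_sub_const_mul hv1 tx.isSupRegular _ hs0 hs1,
      secondDiffLaplacian_sub_const_mul hru tp.isSupRegular _ hs0 hs1]
    have h1 := hsup.secondDiffLaplacian_convol_nonneg hu hB hρ hs0 hs1 y
    have h2 := hLp y hyx
    have h3 := (abs_le.1 (hM y)).2
    have h4 : c * (secondDiffLaplacian s bp y + t * secondDiffLaplacian s bx y) ≤ 0 := by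
      refine mul_nonpos_of_nonneg_of_nonpos hc0.le ?_
      have := mul_le_mul_of_nonneg_left h3 ht0.le
      linarith
    linarith) x₀
  have e1 : bp x₀ = 0 := hsep x₀ (by simpa using hr)
  have e2 : bx x₀ = 1 := bx.one_of_mem_closedBall (by simpa using bx.rIn_pos.le)
  simp only [hv, e1, e2, mul_zero, mul_one, sub_zero] at hvn
  linarith

end Positivity

/-- Mollified solutions have Laplacian bounded below away from the contact set. -/
lemma exists_le_laplacian_convol [NeZero n] {u : Euc n → ℝ} {K : Set (Euc n)}
    (hu : Continuous u) (h0 : Tendsto u (cocompact (Euc n)) (𝓝 0))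
    (hsup : FracSuperharmonic s u) (hK : Bornology.IsBounded K) (hharm : FracHarmonicOn s u Kᶜ)
    (hpos : ∀ x, 0 < u x) (hs0 : 0 < s) (hs1 : s < 1) (R₁ : ℝ) :
    ∃ c > 0, ∀ ε, 0 < ε → ε ≤ 1 → ∀ ρ, IsMollifier ε ρ → ∀ x, ‖x‖ ≤ R₁ →
      Metric.closedBall x ε ⊆ Kᶜ → c ≤ Δ (convol u ρ) x := by
  obtain ⟨B, hB⟩ := exists_bound_of_tendsto_cocompact hu h0
  obtain ⟨R, hR0, hR⟩ := hK.exists_pos_norm_le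
  obtain ⟨A, hA, hcomp⟩ := exists_secondDiffLaplacian_comp_eq (n := n) hs0 hs1
  have hs0' : 0 < 1 - s := by linarith
  have hs1' : 1 - s < 1 := by linarith
  have reg : ∀ {ε ρ}, IsMollifier ε ρ → IsSupRegular (convol u (secondDiffLaplacian s ρ)) :=
    fun hρ => isSupRegular_convol hu hB (hρ.test.isL1Regular_secondDiffLaplacian hs0 hs1)
  have nonneg : ∀ {ε ρ}, IsMollifier ε ρ → ∀ x, 0 ≤ convol u (secondDiffLaplacian s ρ) x :=
    fun hρ x => hsup.convol_nonneg hρ.test hρ.nonneg hs0 hs1 x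
  have supp : ∀ {ε ρ}, ε ≤ 1 → IsMollifier ε ρ → ∀ x,
      convol u (secondDiffLaplacian s ρ) x ≠ 0 → ‖x‖ ≤ R + 1 := by
    intro ε ρ hε hρ x hx
    by_contra! hlt
    refine hx (hharm.convol_eq_zero hρ.test hρ.eq_zero hs0 hs1 fun y hy hyK => ?_)
    have h1 := hR y hyK
    rw [mem_closedBall_iff_norm'] at hy
    have h2 := norm_sub_norm_le x y
    linarith
  have int : ∀ {ε ρ}, ε ≤ 1 → IsMollifier ε ρ →
      Integrable (convol u (secondDiffLaplacian s ρ)) := by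
    intro ε ρ hε hρ
    refine (reg hρ).continuous.integrable_of_hasCompactSupport
      (HasCompactSupport.intro (isCompact_closedBall (0 : Euc n) (R + 1)) fun x hx => ?_)
    by_contra h
    exact hx (by simpa using supp hε hρ x h)
  obtain ⟨ρ₁, hρ₁⟩ := exists_isMollifier n one_pos
  set M := ∫ x, convol u (secondDiffLaplacian s ρ₁) x with hM
  -- With zero mass, u*(Lρ₁) would vanish identically, and the minimum principle applied to -u*ρ₁
  -- would give u*ρ₁ ≤ 0, contradicting u > 0.
  have hM0 : 0 < M := by
    refine lt_of_le_of_ne (integral_nonneg (nonneg hρ₁)) fun hz => ?_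
    have hz' := ((reg hρ₁).continuous.ae_eq_iff_eq volume continuous_const).1
      ((integral_eq_zero_iff_of_nonneg (nonneg hρ₁) (int le_rfl hρ₁)).1 hz.symm)
    have hun : Continuous fun y => -u y := hu.neg
    have hneg : ∀ x, 0 ≤ convol (fun y => -u y) ρ₁ x := by
      refine nonneg_of_secondDiffLaplacian_nonneg (s := s) (isSupRegular_convol hun
        (by simpa using hB) hρ₁.test.isL1Regular) (hρ₁.tendsto_convol hun
          (by simpa using h0.neg)) hs0 hs1 fun x _ => ?_
      rw [secondDiffLaplacian_convol hun (by simpa using hB) hρ₁.test.isL1Regular hs0 hs1,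
        convol_neg_left, congrFun hz' x]
      exact neg_zero.ge
    obtain ⟨y, -, hy⟩ := (isCompact_closedBall (0 : Euc n) 1).exists_isMinOn
      ⟨0, by simp⟩ hu.continuousOn
    have h2 : u y ≤ convol u ρ₁ 0 := hρ₁.le_convol hu hB fun w hw => hy (by
      rw [zero_sub, norm_neg] at hw
      simpa using hw.le)
    have h3 := hneg 0
    rw [convol_neg_left] at h3
    linarith [hpos y]
  -- Bounds the distance from x to the support of u*(Lρ).
  set R₂ := R + 1 + |R₁| with hR₂
  have hR₂0 : 0 < R₂ := by positivity
  set c := 2 * (R₂ ^ ((n : ℝ) + 2 * (1 - s)))⁻¹ * M with hc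
  have hc0 : 0 < c := by positivity
  -- Only A ≥ 0 is known, hence A + 1; the inequality c ≤ A Δ(u*ρ) obtained below itself forces the
  -- Laplacian to be positive.
  refine ⟨c / (A + 1), by positivity, fun ε hε hε1 ρ hρ x hx hxK => ?_⟩
  have hmass : ∫ x, convol u (secondDiffLaplacian s ρ) x = M :=
    integral_convol_secondDiffLaplacian_eq hρ hρ₁ hu hB hs0 hs1 (int hε1 hρ) (int le_rfl hρ₁)
  have hle := secondDiffLaplacian_le_of_eq_zero (reg hρ) (nonneg hρ) (int hε1 hρ) hs0' hs1'
    (hharm.convol_eq_zero hρ.test hρ.eq_zero hs0 hs1 hxK) (R := R₂) (fun y hy => by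
      have h1 := supp hε1 hρ y hy
      have h2 := norm_sub_le y x
      have h3 := le_abs_self R₁
      linarith)
  rw [hmass, secondDiffLaplacian_convol hu hB
    (hρ.test.isL1Regular_secondDiffLaplacian hs0 hs1) hs0' hs1'] at hle
  have heq : convol u (secondDiffLaplacian (1 - s) (secondDiffLaplacian s ρ)) x =
      -(A * Δ (convol u ρ) x) := by
    rw [laplacian_convol hu hB hρ.test, convol, convol, ← integral_const_mul, ← integral_neg]
    refine integral_congr_ae ?_
    have hq := (Measure.measurePreserving_sub_left (volume : Measure (Euc n)) x
      ).quasiMeasurePreserving.ae_eq_comp (hcomp ρ hρ.test)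
    filter_upwards [hq] with y hy
    have hy' : secondDiffLaplacian (1 - s) (secondDiffLaplacian s ρ) (x - y) =
      -(A * Δ ρ (x - y)) := hy
    rw [hy']
    ring
  rw [heq] at hle
  have hAΔ : c ≤ A * Δ (convol u ρ) x := by linarith
  have hΔ : 0 < Δ (convol u ρ) x := pos_of_mul_pos_right (hc0.trans_le hAΔ) hA
  rw [div_le_iff₀ (by linarith)]
  linarith

/-- Quadratic growth away from a point of the noncontact set. -/
lemma exists_mul_sq_le_of_laplacian [NeZero n] {u φ : Euc n → ℝ} {B c R₁ : ℝ} (hu : Continuous u)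
    (hB : ∀ x, |u x| ≤ B) (hφ : ContDiff ℝ 2 φ) (hle : ∀ x, φ x ≤ u x) (hc : 0 < c)
    (hΔ : ∀ ε, 0 < ε → ε ≤ 1 → ∀ ρ, IsMollifier ε ρ → ∀ x, ‖x‖ ≤ R₁ →
      Metric.closedBall x ε ⊆ {x | u x = φ x}ᶜ → c ≤ Δ (convol u ρ) x)
    {x₁ : Euc n} {r : ℝ} (hr : 0 < r) (hx₁ : u x₁ ≠ φ x₁)
    (hball : ∀ x ∈ Metric.closedBall x₁ r, ‖x‖ ≤ R₁ ∧ Δ φ x ≤ 0) :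
    ∃ y ∈ Metric.closedBall x₁ r, c / (4 * n) * r ^ 2 ≤ u y - φ y := by
  by_contra! hcon
  have hn : (0 : ℝ) < n := by exact_mod_cast NeZero.pos n
  -- The paraboloid then has Laplacian c/2, strictly less than c.
  set a := c / (4 * n) with ha
  have ha0 : 0 < a := by positivity
  have hφc := hφ.continuous
  set w : Euc n → ℝ := fun y => u y - φ y - a * ‖y - x₁‖ ^ 2 with hw
  have hwc : Continuous w := by fun_prop
  obtain ⟨η, hη, hηw⟩ : ∃ η > 0, w x₁ = 2 * η := by
    refine ⟨w x₁ / 2, ?_, by ring⟩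
    have : φ x₁ < u x₁ := lt_of_le_of_ne (hle x₁) hx₁.symm
    simp only [hw, sub_self, norm_zero]
    linarith
  have hcomp : IsCompact (Metric.closedBall x₁ r) := isCompact_closedBall x₁ r
  -- A compact set at positive distance from contact; it will contain the maximum point of the
  -- mollified function, so small balls about that point avoid contact.
  set S := Metric.closedBall x₁ r ∩ {y | η ≤ w y} with hS
  have hScomp : IsCompact S := hcomp.inter_right (isClosed_le continuous_const hwc)
  have hSK : S ⊆ {x | u x = φ x}ᶜ := fun y hy hyK => by
    have h1 : η ≤ w y := hy.2
    have h2 : u y = φ y := hyK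
    simp only [hw, h2, sub_self, zero_sub] at h1
    have : 0 ≤ a * ‖y - x₁‖ ^ 2 := by positivity
    linarith
  have hopen : IsOpen {x | u x = φ x}ᶜ := (isClosed_eq hu hφc).isOpen_compl
  obtain ⟨ε₀, hε₀, hε₀K⟩ := hScomp.exists_cthickening_subset_open hopen hSK
  have hunif := (isCompact_closedBall x₁ (r + 1)).uniformContinuousOn_of_continuous
    hu.continuousOn
  -- With error η/3, the maximum of W is at least 2η - η/3, so w there is at least 4η/3.
  obtain ⟨δ, hδ, hδu⟩ := Metric.uniformContinuousOn_iff.1 hunif (η / 3) (by linarith)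
  obtain ⟨ε, hε, hε1, hεε₀, hεδ⟩ : ∃ ε > 0, ε ≤ 1 ∧ ε ≤ ε₀ ∧ ε ≤ δ :=
    ⟨min 1 (min ε₀ δ), by positivity, min_le_left _ _,
      (min_le_right _ _).trans (min_le_left _ _), (min_le_right _ _).trans (min_le_right _ _)⟩
  obtain ⟨ρ, hρ⟩ := exists_isMollifier n hε
  have hclose : ∀ y ∈ Metric.closedBall x₁ r, |convol u ρ y - u y| ≤ η / 3 := by
    intro y hy
    have hy' : ‖y - x₁‖ ≤ r := mem_closedBall_iff_norm.1 hy
    have key : ∀ z, ‖y - z‖ < ε → |u z - u y| < η / 3 := fun z hz => by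
      refine hδu z (mem_closedBall_iff_norm.2 ?_) y (mem_closedBall_iff_norm.2 (by linarith)) ?_
      · have := norm_sub_le_norm_sub_add_norm_sub z y x₁
        rw [norm_sub_rev z y] at this
        linarith
      · rw [dist_comm, dist_eq_norm]
        linarith
    have h1 := hρ.le_convol hu hB (x := y) (a := u y - η / 3) fun z hz => by
      linarith [(abs_lt.1 (key z hz)).1]
    have h2 := hρ.convol_le hu hB (x := y) (a := u y + η / 3) fun z hz => by
      linarith [(abs_lt.1 (key z hz)).2]
    exact abs_le.2 ⟨by linarith, by linarith⟩
  have hquad : ContDiff ℝ 2 (fun y : Euc n => ‖y - x₁‖ ^ 2) :=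
    (contDiff_id.sub contDiff_const).norm_sq ℝ
  have huε := contDiff_convol hu hρ.test
  set W : Euc n → ℝ := (convol u ρ - φ) - a • (fun y => ‖y - x₁‖ ^ 2) with hW
  have huφ : ContDiff ℝ 2 (convol u ρ - φ) := huε.sub hφ
  have haq : ContDiff ℝ 2 (a • fun y : Euc n => ‖y - x₁‖ ^ 2) := hquad.const_smul a
  have hWC : ContDiff ℝ 2 W := huφ.sub haq
  have hWw : ∀ y ∈ Metric.closedBall x₁ r, |W y - w y| ≤ η / 3 := fun y hy => by
    have : W y - w y = convol u ρ y - u y := by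
      simp only [hW, hw, Pi.sub_apply, Pi.smul_apply, smul_eq_mul]
      ring
    rw [this]
    exact hclose y hy
  have hx₁mem : x₁ ∈ Metric.closedBall x₁ r := Metric.mem_closedBall_self hr.le
  obtain ⟨y, hy, hmax⟩ := hcomp.exists_isMaxOn ⟨x₁, hx₁mem⟩ hWC.continuous.continuousOn
  have hwy : η ≤ w y := by
    have h1 : W x₁ ≤ W y := hmax hx₁mem
    have h2 := (abs_le.1 (hWw x₁ hx₁mem)).1
    have h3 := (abs_le.1 (hWw y hy)).2
    linarith
  have hyS : y ∈ S := ⟨hy, hwy⟩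
  -- On the sphere the negated conclusion makes w negative, so the maximum is interior.
  have hyr : ‖y - x₁‖ < r := by
    refine lt_of_le_of_ne (mem_closedBall_iff_norm.1 hy) fun heq => ?_
    have := hcon y hy
    simp only [hw, heq] at hwy
    linarith
  have hloc : IsLocalMax W y :=
    hmax.isLocalMax (mem_of_superset (Metric.isOpen_ball.mem_nhds (mem_ball_iff_norm.2 hyr))
      Metric.ball_subset_closedBall)
  have h1 := laplacian_nonpos_of_isLocalMax hWC hloc
  have hyK : Metric.closedBall y ε ⊆ {x | u x = φ x}ᶜ :=
    (Metric.closedBall_subset_closedBall hεε₀).trans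
      ((Metric.closedBall_subset_cthickening hyS ε₀).trans hε₀K)
  have h2 := hΔ ε hε hε1 ρ hρ y (hball y hy).1 hyK
  have h3 := (hball y hy).2
  rw [hW, ContDiffAt.laplacian_sub huφ.contDiffAt haq.contDiffAt,
    ContDiffAt.laplacian_sub huε.contDiffAt hφ.contDiffAt,
    InnerProductSpace.laplacian_smul a hquad.contDiffAt, laplacian_norm_sub_sq] at h1
  have h4 : a • (2 * (n : ℝ)) = c / 2 := by
    rw [ha, smul_eq_mul]
    field_simp
    norm_num
  linarith

end FracObstacle

/-! ### The nondegeneracy theorem. -/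

theorem lemma3p1 (n : ℕ) (hn : 1 ≤ n) (s : ℝ) (hs0 : 0 < s) (hs1 : s < 1)
    (γ : ℝ≥0) (hγ : 0 < γ)
    (φ u : EuclideanSpace ℝ (Fin n) → ℝ)
    (hφ : FracObstacle.IsGlobalObstacle γ φ)
    (hu : FracObstacle.IsGlobalSolution s φ u) :
    ∃ c₁ > 0, ∃ r₁ > 0, ∀ x₀ ∈ FracObstacle.freeBoundary φ u, ∀ r : ℝ, 0 < r → r < r₁ →
      c₁ * r ^ 2 ≤ sSup ((fun x => u x - φ x) '' Metric.ball x₀ r) := by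
  have : NeZero n := ⟨by omega⟩
  have hφ2 : ContDiff ℝ 2 φ := hφ.regular.1.of_le (by norm_num)
  obtain ⟨p, hp⟩ := hφ.nonempty
  have hpos : ∀ x, 0 < u x := fun x => hu.superharmonic.pos hu.continuous hu.tendsto_zero hs0 hs1
    (lt_of_lt_of_le hp (hu.obstacle_le p)) x
  obtain ⟨B, hB⟩ := FracObstacle.exists_bound_of_tendsto_cocompact hu.continuous hu.tendsto_zero
  set K := {x | u x = φ x} with hK
  have hKclosed : IsClosed K := isClosed_eq hu.continuous hφ2.continuous
  have hKpos : K ⊆ {x | 0 < φ x} := fun x hx => by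
    have h1 : u x = φ x := hx
    have h2 := hpos x
    rw [h1] at h2
    exact h2
  have hKcomp : IsCompact K :=
    hφ.compactly_contained.of_isClosed_subset hKclosed (hKpos.trans subset_closure)
  have hharm : FracObstacle.FracHarmonicOn s u Kᶜ := by
    have : Kᶜ = {x | φ x < u x} := by
      ext x
      exact ⟨fun h => lt_of_le_of_ne (hu.obstacle_le x) (Ne.symm h), fun h h' => h.ne' h'⟩
    rw [this]
    exact hu.harmonic_off_contact
  -- This δ serves as r₁: balls of smaller radius about contact points stay in {φ > 0}, where Δφ ≤
  -- 0.
  obtain ⟨δ, hδ, hδφ⟩ := hKcomp.exists_cthickening_subset_open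
    (isOpen_lt continuous_const hφ2.continuous) hKpos
  obtain ⟨R, -, hR⟩ := hφ.compactly_contained.isBounded.exists_pos_norm_le
  obtain ⟨c, hc, hΔ⟩ := FracObstacle.exists_le_laplacian_convol hu.continuous hu.tendsto_zero
    hu.superharmonic hKcomp.isBounded hharm hpos hs0 hs1 R
  have hn0 : (0 : ℝ) < n := by exact_mod_cast hn
  refine ⟨c / (16 * n), by positivity, δ, hδ, fun x₀ hx₀ r hr hrδ => ?_⟩
  have hx₀K : x₀ ∈ K := hKclosed.frontier_subset hx₀
  have hx₀c : x₀ ∈ closure Kᶜ := by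
    rw [FracObstacle.freeBoundary, frontier_eq_closure_inter_closure] at hx₀
    exact hx₀.2
  -- The growth estimate needs a noncontact centre; within r/4 of x₀, its closed ball of radius r/2
  -- fits in the r-ball. Halving the radius turns 4n into 16n.
  obtain ⟨x₁, hx₁K, hx₁⟩ := Metric.mem_closure_iff.1 hx₀c (r / 4) (by linarith)
  have hsub : Metric.closedBall x₁ (r / 2) ⊆ Metric.ball x₀ r :=
    Metric.closedBall_subset_ball' (by rw [dist_comm]; linarith)
  have hsubφ : Metric.closedBall x₀ r ⊆ {x | 0 < φ x} :=
    (Metric.closedBall_subset_closedBall hrδ.le).trans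
      ((Metric.closedBall_subset_cthickening hx₀K δ).trans hδφ)
  obtain ⟨y, hy, hyu⟩ := FracObstacle.exists_mul_sq_le_of_laplacian hu.continuous hB hφ2
    hu.obstacle_le hc hΔ (x₁ := x₁) (r := r / 2) (by linarith) hx₁K fun x hx => by
      have hxφ := hsubφ (Metric.ball_subset_closedBall (hsub hx))
      exact ⟨hR x (subset_closure hxφ), hφ.laplacian_nonpos x hxφ⟩
  have hbdd : BddAbove ((fun x => u x - φ x) '' Metric.ball x₀ r) :=
    (((isCompact_closedBall x₀ r).image
      (hu.continuous.sub hφ2.continuous)).bddAbove).mono (image_mono Metric.ball_subset_closedBall)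
  calc c / (16 * n) * r ^ 2 = c / (4 * n) * (r / 2) ^ 2 := by ring
    _ ≤ u y - φ y := hyu
    _ ≤ _ := le_csSup hbdd ⟨y, hsub hy, rfl⟩
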